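/- Throughout, systems are finite-dimensional; for a system $S$ with Hilbert space of dimension $d_S$ write $|S|=\log_2 d_S$ (its number of qubits), and $|ST|=|S|+|T|$. Let $|\Psi\rangle_{EHB}=\sum_{ijk}\Psi_{ijk}|i\rangle_E|j\rangle_H|k\rangle_B$ be a unit vector, let $V_\Psi=\sqrt{d_B}\sum_{ijk}\Psi_{ijk}\,|i\rangle_E\otimes|j\rangle_H\otimes\langle k|_{\tilde B}$ be the encoding map $\mathcal H_{\tilde B}\to\mathcal H_{EH}$ that it defines ($\mathcal H_{\tilde B}=\mathcal H_B$), and let $\mathcal C=\operatorname{im}V_\Psi\subseteq\mathcal H_{EH}$ be its code subspace. A code state is a density operator supported on $\mathcal C$. Let $\mathcal E$ be a quantum channel on $E$ with purification $U_{\mathcal E}$, i.e. $U_{\mathcal E}$ is a unitary on $OE$ and $|\omega\rangle_O$ a unit vector with $\mathcal E(\rho)=\mathrm{Tr}_O\big(U_{\mathcal E}(|\omega\rangle\langle\omega|\otimes\rho)U_{\mathcal E}^\dagger\big)$ for all $\rho$. For a unit vector $|\psi\rangle_{EHB}$ let $\sigma^\psi_{OB}$ be the reduced state on $OB$ of $(U_{\mathcal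 E}\otimes I_{HB})(|\omega\rangle_O\otimes|\psi\rangle_{EHB})$, with marginals $\sigma^\psi_O,\sigma^\psi_B$. For $\delta>0$ say that the decoupling bound $\delta$ holds for $\psi$ if $\|\sigma^\psi_{OB}-\sigma^\psi_O\otimes\sigma^\psi_B\|_1\le\delta$, where $\|A\|_1=\mathrm{Tr}\sqrt{A^\dagger A}$, and that it holds for all code states if it holds for every $|\psi\rangle_{EHB}$ that purifies a code state, with $B$ as the purifying system. $\mathcal E$ is called $\epsilon$-correctable for $V_\Psi$ if there is a channel $\mathcal R$ on $EH$ such that $\max_\rho\sqrt{1-F_\rho(\mathcal R\circ(\mathcal E\otimes\mathcal I_H),\mathcal I)}\le\epsilon$, the maximum being over all code states $\rho$. Here $F_\rho(\mathcal M,\mathcal N)=f\big[(\mathcal M\otimes\mathcal I)(|\phi\rangle\langle\phi|),(\mathcal N\otimes\mathcal I)(|\phi\rangle\langle\phi|)\big]$ with $|\phi\rangle$ a purification of $\rho$, and $f(\rho,\tau)=\mathrm{Tr}\sqrt{\sqrt\tau\rho\sqrt\tau}$. Let $\alpha$ be a real number. (a) Let $B$ be a single qubit. If the decoupling bound $6\cdot2^{-(\alpha|H|-|O|)}$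 holds for all code states, then $\mathcal E$ is $\epsilon$-correctable for $V_\Psi$ with $\epsilon=\sqrt3\cdot2^{-(\alpha|H|-|O|)/2}$. If $V_\Psi$ is exactly an isometry, it suffices for this conclusion that the decoupling bound $6\cdot2^{-(\alpha|H|-|O|)}$ holds for $\psi=\Psi$. (b) For $B$ of any dimension, if the decoupling bound $3\cdot2^{-(\alpha|H|-|OB|)}$ holds for all code states, then $\mathcal E$ is $\epsilon$-correctable for $V_\Psi$ with $\epsilon=\sqrt{3/2}\cdot2^{-(\alpha|H|-|OB|)/2}$. -/

import Mathlib

noncomputable section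

namespace BlackHoleCode

open scoped Matrix ComplexOrder MatrixOrder Kronecker

variable {A A' R O E H B : Type*}
  [Fintype A] [DecidableEq A] [Fintype A'] [DecidableEq A'] [Fintype R] [DecidableEq R]
  [Fintype O] [DecidableEq O] [Fintype E] [DecidableEq E] [Fintype H] [DecidableEq H]
  [Fintype B] [DecidableEq B]

/-- The number of qubits `|S|` of the system with Hilbert space `S → ℂ`, so that `2 ^ |S|` is the
dimension of that space. -/
def numQubits (S : Type*) [Fintype S] : ℝ := Real.logb 2 (Fintype.card S)

/-- `ψ` is a unit vector for the `ℓ²` norm. -/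
def IsUnitVec (ψ : A → ℂ) : Prop := ∑ a, ‖ψ a‖ ^ 2 = 1

/-- The rank-one operator `|ψ⟩⟨ψ|`. -/
def proj (ψ : A → ℂ) : Matrix A A ℂ := Matrix.vecMulVec ψ (star ψ)

/-- Density operators. -/
def IsState (ρ : Matrix A A ℂ) : Prop := ρ.PosSemidef ∧ ρ.trace = 1

/-- The partial trace over the first tensor factor. -/
def traceFst (M : Matrix (A × R) (A × R) ℂ) : Matrix R R ℂ :=
  Matrix.of fun r r' => ∑ a, M (a, r) (a, r')

/-- The partial trace over the second tensor factor. -/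
def traceSnd (M : Matrix (A × R) (A × R) ℂ) : Matrix A A ℂ :=
  Matrix.of fun a a' => ∑ r, M (a, r) (a', r)

/-- The trace norm `‖M‖₁ = Tr √(M† M)`. -/
def traceNorm (M : Matrix A A ℂ) : ℝ := (CFC.sqrt (Mᴴ * M)).trace.re

/-- The fidelity `f(ρ, τ) = Tr √(√τ ρ √τ)`. -/
def fidelity (ρ τ : Matrix A A ℂ) : ℝ :=
  (CFC.sqrt (CFC.sqrt τ * ρ * CFC.sqrt τ)).trace.re

/-- The map `Φ ⊗ id` on operators on `A ⊗ R`, for a linear map `Φ` on operators on `A`: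
`Φ` is applied to each block `⟨x|M|y⟩`, where `x, y` are basis vectors of `R`. -/
def ampliation (R : Type*) (Φ : Matrix A A ℂ →ₗ[ℂ] Matrix A' A' ℂ) :
    Matrix (A × R) (A × R) ℂ →ₗ[ℂ] Matrix (A' × R) (A' × R) ℂ where
  toFun M := Matrix.of fun i j =>
    Φ (Matrix.of fun a a' => M (a, i.2) (a', j.2)) i.1 j.1
  map_add' M N := by
    ext i j
    exact congrArg (fun X => X i.1 j.1)
      (map_add Φ (Matrix.of fun a a' => M (a, i.2) (a', j.2))
        (Matrix.of fun a a' => N (a, i.2) (a', j.2)))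
  map_smul' c M := by
    ext i j
    exact congrArg (fun X => X i.1 j.1)
      (map_smul Φ c (Matrix.of fun a a' => M (a, i.2) (a', j.2)))

/-- Quantum channels: completely positive trace-preserving maps. -/
def IsChannel (Φ : Matrix A A ℂ →ₗ[ℂ] Matrix A' A' ℂ) : Prop :=
  (∀ M, (Φ M).trace = M.trace) ∧
    ∀ (n : ℕ) (M : Matrix (A × Fin n) (A × Fin n) ℂ),
      M.PosSemidef → (ampliation (Fin n) Φ M).PosSemidef

/-- The vector `ψ` of `A ⊗ R` is a purification of the operator `ρ` on `A`. -/
def IsPurification (ψ : A × R → ℂ) (ρ : Matrix A A ℂ) : Prop := traceSnd (proj ψ) = ρ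

/-- The canonical purification `∑ a, √ρ |a⟩ ⊗ |a⟩` of `ρ`. -/
def canonicalPurification (ρ : Matrix A A ℂ) : A × A → ℂ := fun p => CFC.sqrt ρ p.1 p.2

theorem isPurification_canonicalPurification {ρ : Matrix A A ℂ} (hρ : ρ.PosSemidef) :
    IsPurification (canonicalPurification ρ) ρ := by
  have h0 : (0 : Matrix A A ℂ) ≤ ρ := Matrix.nonneg_iff_posSemidef.mpr hρ
  have h1 : (CFC.sqrt ρ)ᴴ = CFC.sqrt ρ :=
    (Matrix.nonneg_iff_posSemidef.mp (CFC.sqrt_nonneg ρ)).isHermitian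
  have h2 : CFC.sqrt ρ * (CFC.sqrt ρ)ᴴ = ρ := by
    rw [h1]; exact CFC.sqrt_mul_sqrt_self ρ h0
  unfold IsPurification
  conv_rhs => rw [← h2]
  ext a a'
  simp [traceSnd, proj, canonicalPurification, Matrix.mul_apply, Matrix.vecMulVec_apply]

/-- The entanglement fidelity `F_ρ(Φ, Φ')`: the fidelity of the images of a purification of `ρ`
under `Φ ⊗ id` and `Φ' ⊗ id`. It does not depend on the purification; the canonical one is used. -/
def entanglementFidelity (Φ Φ' : Matrix A A ℂ →ₗ[ℂ] Matrix A' A' ℂ) (ρ : Matrix A A ℂ) : ℝ :=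
  fidelity (ampliation A Φ (proj (canonicalPurification ρ)))
    (ampliation A Φ' (proj (canonicalPurification ρ)))

/-- The density operators with support in the subspace `C`. -/
def codeStates (C : Submodule ℂ (A → ℂ)) : Set (Matrix A A ℂ) :=
  {ρ | IsState ρ ∧ LinearMap.range ρ.mulVecLin ≤ C}

/-- The Bures distance of two channels, the maximum being over the states with support in `C`. -/
def buresDist (C : Submodule ℂ (A → ℂ)) (Φ Φ' : Matrix A A ℂ →ₗ[ℂ] Matrix A' A' ℂ) : ℝ :=
  sSup ((fun ρ => √(1 - entanglementFidelity Φ Φ' ρ)) '' codeStates C)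

/-- The noise channel `𝒩` is `ε`-correctable with respect to the code subspace `C`. -/
def IsCorrectable (C : Submodule ℂ (A → ℂ)) (𝒩 : Matrix A A ℂ →ₗ[ℂ] Matrix A A ℂ) (ε : ℝ) :
    Prop :=
  ∃ ℛ : Matrix A A ℂ →ₗ[ℂ] Matrix A A ℂ,
    IsChannel ℛ ∧ buresDist C (ℛ ∘ₗ 𝒩) LinearMap.id ≤ ε

/-- The encoding map `V_Ψ : B̃ → E ⊗ H`, `V_Ψ = √d_B ∑ Ψ_{ijk} |i⟩_E ⊗ |j⟩_H ⊗ ⟨k|`. -/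
def encoding (Ψ : (E × H) × B → ℂ) : Matrix (E × H) B ℂ :=
  Matrix.of fun x k => (√(Fintype.card B : ℝ) : ℂ) * Ψ (x, k)

/-- The code subspace: the image of `V_Ψ` in `E ⊗ H`. -/
def codeSpace (Ψ : (E × H) × B → ℂ) : Submodule ℂ (E × H → ℂ) :=
  LinearMap.range (encoding Ψ).mulVecLin

/-- `V_Ψ` is an isometry, i.e. `B` is maximally mixed in `Ψ`. -/
def IsIsometricEncoding (Ψ : (E × H) × B → ℂ) : Prop := (encoding Ψ)ᴴ * encoding Ψ = 1

/-- The unitary `U` on `O ⊗ E`, with `O` initialized in the pure state `ω`, is a purification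
(dilation) of the map `𝓔` on operators on `E`. -/
def IsDilation (U : Matrix (O × E) (O × E) ℂ) (ω : O → ℂ)
    (𝓔 : Matrix E E ℂ →ₗ[ℂ] Matrix E E ℂ) : Prop :=
  U ∈ Matrix.unitaryGroup (O × E) ℂ ∧ IsUnitVec ω ∧
    ∀ ρ, 𝓔 ρ = traceFst (U * (proj ω ⊗ₖ ρ) * Uᴴ)

/-- The vector `(U ⊗ I_{HB}) (ω ⊗ ψ)` of `(O ⊗ B) ⊗ (E ⊗ H)`, for `ψ` in `E ⊗ H ⊗ B`. -/
def evolve (U : Matrix (O × E) (O × E) ℂ) (ω : O → ℂ) (ψ : (E × H) × B → ℂ) :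
    (O × B) × (E × H) → ℂ :=
  fun p => ∑ q : O × E, U (p.1.1, p.2.1) q * (ω q.1 * ψ ((q.2, p.2.2), p.1.2))

/-- The reduced state on `O ⊗ B` after the evolution. -/
def stateOB (U : Matrix (O × E) (O × E) ℂ) (ω : O → ℂ) (ψ : (E × H) × B → ℂ) :
    Matrix (O × B) (O × B) ℂ :=
  traceSnd (proj (evolve U ω ψ))

/-- The deviation from decoupling `‖σ_{OB} - σ_O ⊗ σ_B‖₁` after the evolution of `ω ⊗ ψ`. -/
def decouplingError (U : Matrix (O × E) (O × E) ℂ) (ω : O → ℂ) (ψ : (E × H) × B → ℂ) : ℝ :=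
  traceNorm (stateOB U ω ψ - traceSnd (stateOB U ω ψ) ⊗ₖ traceFst (stateOB U ω ψ))

/-- The decoupling bound with right-hand side `δ` for all states of the code defined by `Ψ`:
`O` and `B` decouple up to `δ` whenever `U` acts on `ω ⊗ ψ`, with `ψ` in `E ⊗ H ⊗ B` a purification
by `B` of a code state. -/
def DecouplingBound (Ψ : (E × H) × B → ℂ) (U : Matrix (O × E) (O × E) ℂ) (ω : O → ℂ)
    (δ : ℝ) : Prop :=
  ∀ ρ ∈ codeStates (codeSpace Ψ), ∀ ψ : (E × H) × B → ℂ,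
    IsPurification ψ ρ → decouplingError U ω ψ ≤ δ

end BlackHoleCode

end

noncomputable section

namespace BlackHoleCode

open scoped Matrix ComplexOrder MatrixOrder Kronecker

set_option linter.unusedSectionVars false

/-! ### Contractions and traces -/

section Contractions

variable {m n k : Type*} [Fintype m] [DecidableEq m] [Fintype n] [DecidableEq n]
  [Fintype k] [DecidableEq k]

/-! In every case the claimed `ε` equals `√(δ / 2)`, where `δ` is the assumed decoupling bound; the
exponentials play no further role. What is needed is one recovery channel whose entanglement
fidelity is at least `1 - δ / 2` on all code states.

Fix a code state with purification `ψ` in `E ⊗ H ⊗ B`. After the noise the global vector on `O`, `B`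
and `E ⊗ H` purifies the state `σ` of `O ⊗ B`. If `S` is a state of `O`, the product of `S` with the
`B`-marginal of `ψ` is purified by `√S ⊗ ψ`, which uses a second copy of `O`. As in Uhlmann's
theorem, the polar decompositions of these two vectors give a contraction from `E ⊗ H` to `O ⊗ E ⊗
H`. Completed to a channel that discards `O`, it recovers `ψ` with fidelity at least `Tr √σ √τ`,
where `τ` is the product state (`exists_recovery_sqrt`). The Powers–Størmer inequality bounds this
below by `1 - ‖σ - τ‖₁ / 2` (`exists_powersStormer`).

This channel depends on the code state. The squared entanglement fidelity, however, is convex in the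
state and affine in the Choi matrix of the recovery, and both range over compact convex sets. Sion's
minimax theorem therefore exchanges the quantifiers (`exists_recovery_of_forall`). With `S` the
`O`-marginal of `σ`, this settles the two claims that assume decoupling for all code states.

For an isometric qubit code with decoupling known only for `Ψ`, each code state has a purification
obtained from `Ψ` by an operator on `B`, namely `√2` times a unitary and the square root of a
diagonal qubit state. Take `S` to be the `O`-marginal belonging to `Ψ`. The operator on `B` enlarges
the trace-norm error by at most `3 / 2` (`re_trace_conj_diagonal_le`). On the other hand `σ ≤ 4 τ`,
which improves the constant in Powers–Størmer from `1 / 2` to `1 / 3`. The two factors cancel, so `δ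
/ 2` survives. -/

/-- The matrix `T` does not increase the `ℓ²` norm. -/
def IsContraction (T : Matrix m n ℂ) : Prop := (1 - Tᴴ * T).PosSemidef

theorem trace_mul_nonneg {A B : Matrix n n ℂ} (hA : A.PosSemidef) (hB : B.PosSemidef) :
    0 ≤ (A * B).trace.re := by
  obtain ⟨C, rfl⟩ := CStarAlgebra.nonneg_iff_eq_star_mul_self.mp
    (Matrix.nonneg_iff_posSemidef.mpr hA)
  rw [Matrix.mul_assoc, Matrix.trace_mul_comm]
  exact (Complex.le_def.mp (hB.mul_mul_conjTranspose_same C).trace_nonneg).1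

/-- Both conditions are Schur complements of the same block matrix with identity diagonal blocks and
off-diagonal blocks `T` and `Tᴴ`, so each is equivalent to its positivity. -/
theorem IsContraction.conjTranspose {T : Matrix m n ℂ} (hT : IsContraction T) :
    IsContraction Tᴴ := by
  let _ : Invertible (1 : Matrix m m ℂ) := invertibleOne
  let _ : Invertible (1 : Matrix n n ℂ) := invertibleOne
  have h1 := Matrix.PosDef.fromBlocks₁₁ (A := (1 : Matrix m m ℂ)) T 1 Matrix.PosDef.one
  have h2 := Matrix.PosDef.fromBlocks₂₂ (D := (1 : Matrix n n ℂ)) 1 T Matrix.PosDef.one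
  simp only [inv_one, Matrix.mul_one] at h1 h2
  unfold IsContraction at hT ⊢
  rw [Matrix.conjTranspose_conjTranspose]
  exact h2.mp (h1.mpr hT)

theorem IsContraction.transpose {T : Matrix m n ℂ} (hT : IsContraction T) :
    IsContraction Tᵀ := by
  have h := Matrix.PosSemidef.transpose hT.conjTranspose
  rw [Matrix.conjTranspose_conjTranspose, Matrix.transpose_sub, Matrix.transpose_mul,
    Matrix.transpose_one] at h
  exact h

theorem IsContraction.mul {S : Matrix m n ℂ} {T : Matrix n k ℂ} (hS : IsContraction S)
    (hT : IsContraction T) : IsContraction (S * T) := by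
  have h := (hS.conjTranspose_mul_mul_same T).add hT
  unfold IsContraction
  convert h using 1
  simp only [Matrix.conjTranspose_mul, Matrix.mul_sub, Matrix.sub_mul, Matrix.mul_one,
    Matrix.mul_assoc]
  abel

theorem IsContraction.neg {T : Matrix m n ℂ} (hT : IsContraction T) : IsContraction (-T) := by
  simpa [IsContraction] using hT

/-- The matrix `2 - T - Tᴴ = (1 - T)ᴴ (1 - T) + (1 - Tᴴ T)` is positive, and is paired with `P`. -/
theorem IsContraction.re_trace_mul_le {T P : Matrix n n ℂ} (hT : IsContraction T)
    (hP : P.PosSemidef) : (T * P).trace.re ≤ P.trace.re := by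
  have h := trace_mul_nonneg ((Matrix.posSemidef_conjTranspose_mul_self (1 - T)).add hT) hP
  have e : (1 - T)ᴴ * (1 - T) + (1 - Tᴴ * T) = 1 + 1 - T - Tᴴ := by
    simp only [Matrix.conjTranspose_sub, Matrix.conjTranspose_one]
    noncomm_ring
  have h3 : (Tᴴ * P).trace.re = (T * P).trace.re := by
    have : (Tᴴ * P) = (P * T)ᴴ := by rw [Matrix.conjTranspose_mul, hP.isHermitian.eq]
    rw [this, Matrix.trace_conjTranspose, Matrix.trace_mul_comm]
    simp
  rw [e] at h
  simp only [Matrix.sub_mul, Matrix.add_mul, Matrix.one_mul, Matrix.trace_sub, Matrix.trace_add,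
    Complex.sub_re, Complex.add_re, h3] at h
  linarith

/-- The spectrum is finite, so the functional calculus accepts discontinuous functions; the sign
function and `x ↦ (√x)⁻¹` are used below. -/
theorem continuousOn_spectrum (D : Matrix n n ℂ) (f : ℝ → ℝ) :
    ContinuousOn f (spectrum ℝ D) :=
  D.finite_real_spectrum.continuousOn f

theorem cfc_mul_cfc {D : Matrix n n ℂ} (f g : ℝ → ℝ) :
    cfc f D * cfc g D = cfc (fun x => f x * g x) D :=
  (cfc_mul f g D (continuousOn_spectrum D f) (continuousOn_spectrum D g)).symm

theorem conjTranspose_cfc {D : Matrix n n ℂ} (f : ℝ → ℝ) : (cfc f D)ᴴ = cfc f D :=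
  (IsSelfAdjoint.cfc (f := f) (a := D)).star_eq

theorem posSemidef_cfc {D : Matrix n n ℂ} {f : ℝ → ℝ} (hf : ∀ x ∈ spectrum ℝ D, 0 ≤ f x) :
    (cfc f D).PosSemidef :=
  Matrix.nonneg_iff_posSemidef.mp (cfc_nonneg hf)

theorem isContraction_cfc {D : Matrix n n ℂ} (hD : D.IsHermitian) {f : ℝ → ℝ}
    (hf : ∀ x, f x * f x ≤ 1) : IsContraction (cfc f D) := by
  have h1 : cfc (fun _ : ℝ => (1 : ℝ)) D = 1 := cfc_const_one ℝ D hD.isSelfAdjoint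
  unfold IsContraction
  rw [conjTranspose_cfc, cfc_mul_cfc, ← h1,
    ← cfc_sub _ _ D (continuousOn_spectrum D _) (continuousOn_spectrum D _)]
  exact posSemidef_cfc fun x _ => sub_nonneg.mpr (hf x)

/-- The Jordan decomposition of a Hermitian matrix `D` together with its sign `T`. -/
theorem exists_jordan {D : Matrix n n ℂ} (hD : D.IsHermitian) :
    ∃ P N T : Matrix n n ℂ, P.PosSemidef ∧ N.PosSemidef ∧ P * N = 0 ∧ N * P = 0 ∧ D = P - N ∧
      IsContraction T ∧ T * D = P + N ∧ D * T = P + N := by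
  have hid : cfc (fun x : ℝ => x) D = D := cfc_id' ℝ D hD.isSelfAdjoint
  have key : ∀ f g h : ℝ → ℝ, (∀ x, f x * g x = h x) → cfc f D * cfc g D = cfc h D := by
    intro f g h e
    rw [cfc_mul_cfc]
    exact congrArg (fun f => cfc f D) (funext e)
  have hadd : ∀ f g : ℝ → ℝ, cfc f D + cfc g D = cfc (fun x => f x + g x) D := fun f g =>
    (cfc_add D f g (continuousOn_spectrum D _) (continuousOn_spectrum D _)).symm
  have hsub : ∀ f g : ℝ → ℝ, cfc f D - cfc g D = cfc (fun x => f x - g x) D := fun f g =>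
    (cfc_sub f g D (continuousOn_spectrum D _) (continuousOn_spectrum D _)).symm
  have h0 : cfc (fun _ : ℝ => (0 : ℝ)) D = 0 := cfc_const_zero ℝ D
  refine ⟨cfc (fun x => max x 0) D, cfc (fun x => max (-x) 0) D,
    cfc (fun x => if 0 ≤ x then 1 else -1) D, posSemidef_cfc fun x _ => le_max_right _ _,
    posSemidef_cfc fun x _ => le_max_right _ _, ?_, ?_, ?_, isContraction_cfc hD ?_, ?_, ?_⟩
  · rw [← h0]
    refine key _ _ _ fun x => ?_
    rcases le_total 0 x with h | h <;> simp [h]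
  · rw [← h0]
    refine key _ _ _ fun x => ?_
    rcases le_total 0 x with h | h <;> simp [h]
  · rw [hsub]
    conv_lhs => rw [← hid]
    refine congrArg (fun f => cfc f D) (funext fun x => ?_)
    rcases le_total 0 x with h | h <;> simp [h]
  · intro x
    split_ifs <;> norm_num
  · have h := key (fun x => if 0 ≤ x then 1 else -1) (fun x => x) (fun x => max x 0 + max (-x) 0)
      fun x => by
        rcases le_or_gt 0 x with h | h
        · simp [h]
        · simp [h.le, h.not_ge]
    rw [hid] at h
    rw [hadd, h]
  · have h := key (fun x => x) (fun x => if 0 ≤ x then 1 else -1) (fun x => max x 0 + max (-x) 0)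
      fun x => by
        rcases le_or_gt 0 x with h | h
        · simp [h]
        · simp [h.le, h.not_ge]
    rw [hid] at h
    rw [hadd, h]

/-- The trace norm is `Tr (P + N)` for the Jordan parts of `X`; test `T` against `P` and `-T`
against `N`. -/
theorem IsContraction.re_trace_mul_le_traceNorm {T X : Matrix n n ℂ} (hT : IsContraction T)
    (hX : X.IsHermitian) : (T * X).trace.re ≤ traceNorm X := by
  obtain ⟨P, N, -, hP, hN, hPN, hNP, rfl, -⟩ := exists_jordan hX
  have h : traceNorm (P - N) = (P + N).trace.re := by
    unfold traceNorm
    congr 2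
    rw [CFC.sqrt_eq_iff _ _
      (Matrix.nonneg_iff_posSemidef.mpr (Matrix.posSemidef_conjTranspose_mul_self _))
      (Matrix.nonneg_iff_posSemidef.mpr (hP.add hN)), hX.eq]
    simp only [Matrix.mul_add, Matrix.add_mul, Matrix.sub_mul, Matrix.mul_sub, hPN, hNP]
    abel
  have h1 := hT.re_trace_mul_le hP
  have h2 := hT.neg.re_trace_mul_le hN
  rw [h, Matrix.mul_sub, Matrix.trace_sub, Matrix.trace_add, Complex.sub_re, Complex.add_re]
  rw [Matrix.neg_mul, Matrix.trace_neg, Complex.neg_re] at h2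
  linarith

theorem conjTranspose_sqrt (A : Matrix n n ℂ) : (CFC.sqrt A)ᴴ = CFC.sqrt A :=
  (Matrix.nonneg_iff_posSemidef.mp (CFC.sqrt_nonneg A)).isHermitian

theorem posSemidef_sqrt (A : Matrix n n ℂ) : (CFC.sqrt A).PosSemidef :=
  Matrix.nonneg_iff_posSemidef.mp (CFC.sqrt_nonneg A)

theorem sqrt_mul_sqrt {A : Matrix n n ℂ} (hA : A.PosSemidef) : CFC.sqrt A * CFC.sqrt A = A :=
  CFC.sqrt_mul_sqrt_self A (Matrix.nonneg_iff_posSemidef.mpr hA)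

open scoped Matrix.Norms.L2Operator in
theorem posSemidef_sqrt_sub_sqrt {A B : Matrix n n ℂ} (h : (B - A).PosSemidef) :
    (CFC.sqrt B - CFC.sqrt A).PosSemidef :=
  Matrix.le_iff.mp (CFC.sqrt_le_sqrt A B (Matrix.le_iff.mpr h))

theorem sqrt_four_smul {A : Matrix n n ℂ} (hA : A.PosSemidef) :
    CFC.sqrt ((4 : ℝ) • A) = (2 : ℝ) • CFC.sqrt A := by
  have h4 : ((4 : ℝ) • A).PosSemidef := hA.smul (by norm_num)
  have h2 : ((2 : ℝ) • CFC.sqrt A).PosSemidef := (posSemidef_sqrt A).smul (by norm_num)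
  rw [CFC.sqrt_eq_iff _ _ (Matrix.nonneg_iff_posSemidef.mpr h4)
    (Matrix.nonneg_iff_posSemidef.mpr h2), Matrix.smul_mul, Matrix.mul_smul, smul_smul,
    sqrt_mul_sqrt hA]
  norm_num

/-- The Powers–Størmer inequality, with the contraction that witnesses the trace norm. If moreover
`σ ≤ 4 τ`, the constant improves by the factor `3 / 2`. -/
theorem exists_powersStormer {σ τ : Matrix n n ℂ} (hσ : IsState σ) (hτ : IsState τ) :
    ∃ T : Matrix n n ℂ, IsContraction T ∧
      1 - (T * (σ - τ)).trace.re / 2 ≤ (CFC.sqrt σ * CFC.sqrt τ).trace.re ∧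
      (((4 : ℝ) • τ - σ).PosSemidef →
        1 - (T * (σ - τ)).trace.re / 3 ≤ (CFC.sqrt σ * CFC.sqrt τ).trace.re) := by
  obtain ⟨hσ, tσ⟩ := hσ
  obtain ⟨hτ, tτ⟩ := hτ
  set A := CFC.sqrt σ with hA
  set B := CFC.sqrt τ with hB
  have pA : A.PosSemidef := posSemidef_sqrt σ
  have pB : B.PosSemidef := posSemidef_sqrt τ
  have eA : A * A = σ := sqrt_mul_sqrt hσ
  have eB : B * B = τ := sqrt_mul_sqrt hτ
  obtain ⟨P, N, T, hP, hN, hPN, hNP, hD, hT, hTD, hDT⟩ :=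
    exists_jordan (pA.isHermitian.sub pB.isHermitian)
  have eS : A = B + (P - N) := by rw [← hD]; abel
  have hBA : (B * A).trace = (A * B).trace := Matrix.trace_mul_comm _ _
  -- With `D = A - B`, the difference `2 (σ - τ)` is the anticommutator of `D` and `A + B`, and the
  -- sign `T` turns `D` into `|D| = P + N` from either side.
  have key : (T * (σ - τ)).trace.re = ((P + N) * (A + B)).trace.re := by
    have e : (A - B) * (A + B) + (A + B) * (A - B) = (2 : ℂ) • (σ - τ) := by
      rw [← eA, ← eB, two_smul]; noncomm_ring
    have h1 : (T * ((A - B) * (A + B))).trace = ((P + N) * (A + B)).trace := by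
      rw [← Matrix.mul_assoc, hTD]
    have h2 : (T * ((A + B) * (A - B))).trace = ((P + N) * (A + B)).trace := by
      rw [← Matrix.mul_assoc, Matrix.trace_mul_comm, ← Matrix.mul_assoc, hDT]
    have h3 : (T * ((2 : ℂ) • (σ - τ))).trace = 2 * ((P + N) * (A + B)).trace := by
      rw [← e, Matrix.mul_add, Matrix.trace_add, h1, h2, two_mul]
    rw [Matrix.mul_smul, Matrix.trace_smul, smul_eq_mul] at h3
    rw [mul_left_cancel₀ two_ne_zero h3]
  have hAB : 2 - 2 * (A * B).trace.re = (P * P).trace.re + (N * N).trace.re := by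
    have e : (A - B) * (A - B) = P * P + N * N := by
      rw [hD]
      simp only [Matrix.sub_mul, Matrix.mul_sub, hPN, hNP]
      abel
    have h := congrArg (fun M => (Matrix.trace M).re) e
    simp only [Matrix.sub_mul, Matrix.mul_sub, Matrix.trace_sub, Matrix.trace_add, eA, eB, tσ, tτ,
      hBA, Complex.sub_re, Complex.add_re, Complex.one_re] at h
    linarith
  -- This is where equality of the two traces enters: `Tr D (A + B) = Tr σ - Tr τ = 0`.
  have hS : (P * (A + B)).trace.re = (N * (A + B)).trace.re := by
    have h : ((A - B) * (A + B)).trace.re = 0 := by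
      simp only [Matrix.sub_mul, Matrix.mul_add, Matrix.trace_sub, Matrix.trace_add, eA, eB, tσ, tτ,
        hBA, Complex.sub_re, Complex.add_re, Complex.one_re]
      ring
    rw [hD, Matrix.sub_mul, Matrix.trace_sub, Complex.sub_re] at h
    linarith
  have hPS : (P * (A + B)).trace.re = 2 * (P * B).trace.re + (P * P).trace.re := by
    rw [eS]
    simp only [Matrix.mul_add, Matrix.mul_sub, hPN, Matrix.trace_sub, Matrix.trace_add,
      Complex.sub_re, Complex.add_re, Matrix.trace_zero, Complex.zero_re]
    ring
  have hNS : (N * (A + B)).trace.re = 2 * (N * A).trace.re + (N * N).trace.re := by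
    have eS' : B = A - (P - N) := by rw [← hD]; abel
    rw [eS']
    simp only [Matrix.mul_add, Matrix.mul_sub, hNP, Matrix.trace_sub, Matrix.trace_add,
      Complex.sub_re, Complex.add_re, Matrix.trace_zero, Complex.zero_re]
    ring
  have hPB := trace_mul_nonneg hP pB
  have hNA := trace_mul_nonneg hN pA
  rw [Matrix.add_mul, Matrix.trace_add, Complex.add_re] at key
  refine ⟨T, hT, by linarith, fun h4 => ?_⟩
  -- Operator monotonicity of the square root turns `σ ≤ 4 τ` into `A ≤ 2 B`; paired with `P` this
  -- gives `Tr P B ≥ Tr P²`. Hence `x = Tr T (σ - τ)` satisfies `x ≥ 6 Tr P²` as well as `x ≥ 2 Tr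
  -- N²`. The average with weights `1 / 4` and `3 / 4` is `x ≥ (3 / 2) (Tr P² + Tr N²) = 3 (1 - Tr A
  -- B)`.
  have hle : ((2 : ℝ) • B - A).PosSemidef := by
    rw [hB, ← sqrt_four_smul hτ]
    exact posSemidef_sqrt_sub_sqrt h4
  have h := trace_mul_nonneg hP hle
  have e : (2 : ℝ) • B - A = B - (P - N) := by rw [eS, two_smul]; abel
  rw [e] at h
  simp only [Matrix.mul_sub, hPN, Matrix.trace_sub, Complex.sub_re, Matrix.trace_zero,
    Complex.zero_re] at h
  linarith

/-- A polar decomposition of `X`, up to the choice of the contraction off the support of `X Xᴴ`. -/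
theorem exists_polar (X : Matrix m n ℂ) :
    ∃ V : Matrix m n ℂ, IsContraction V ∧ X * Vᴴ = CFC.sqrt (X * Xᴴ) := by
  have hp : (X * Xᴴ).PosSemidef := Matrix.posSemidef_self_mul_conjTranspose X
  have hid : cfc (fun x : ℝ => x) (X * Xᴴ) = X * Xᴴ := cfc_id' ℝ _ hp.isHermitian.isSelfAdjoint
  have hsp : ∀ x ∈ spectrum ℝ (X * Xᴴ), 0 ≤ x := fun x hx =>
    spectrum_nonneg_of_nonneg (Matrix.nonneg_iff_posSemidef.mpr hp) hx
  -- Since `0⁻¹ = 0`, this is the inverse square root on the support of `X Xᴴ` and zero on its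
  -- kernel, so `g X Xᴴ g` has only the eigenvalues `0` and `1`.
  set g := cfc (fun x : ℝ => (√x)⁻¹) (X * Xᴴ) with hg
  have hgt : gᴴ = g := conjTranspose_cfc _
  refine ⟨g * X, ?_, ?_⟩
  · have h : IsContraction (g * X)ᴴ := by
      have e : (g * X)ᴴᴴ * (g * X)ᴴ = cfc (fun x : ℝ => (√x)⁻¹ * x * (√x)⁻¹) (X * Xᴴ) := by
        rw [Matrix.conjTranspose_conjTranspose, Matrix.conjTranspose_mul, hgt, ← cfc_mul_cfc,
          ← cfc_mul_cfc, hid]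
        simp only [Matrix.mul_assoc, hg]
      have h1 : cfc (fun _ : ℝ => (1 : ℝ)) (X * Xᴴ) = 1 :=
        cfc_const_one ℝ _ hp.isHermitian.isSelfAdjoint
      unfold IsContraction
      rw [e, ← h1, ← cfc_sub _ _ _ (continuousOn_spectrum _ _) (continuousOn_spectrum _ _)]
      refine posSemidef_cfc fun x hx => ?_
      rcases (hsp x hx).eq_or_lt with h | h
      · simp [← h]
      · have h2 : √x ≠ 0 := (Real.sqrt_pos.mpr h).ne'
        have h3 : (√x)⁻¹ * x * (√x)⁻¹ = 1 := by
          field_simp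
          exact (Real.sq_sqrt h.le).symm
        rw [h3, sub_self]
    simpa using h.conjTranspose
  · rw [Matrix.conjTranspose_mul, hgt, ← Matrix.mul_assoc,
      CFC.sqrt_eq_real_sqrt _ (Matrix.nonneg_iff_posSemidef.mpr hp), cfcₙ_eq_cfc]
    have h := cfc_mul_cfc (D := X * Xᴴ) (fun x => x) fun x => (√x)⁻¹
    rw [hid] at h
    rw [hg, h]
    exact congrArg (fun f => cfc f (X * Xᴴ)) (funext fun x => Real.div_sqrt)

end Contractions

/-! ### Recovery channels and the entanglement fidelity -/

section Recovery

variable {A O : Type*} [Fintype A] [DecidableEq A] [Fintype O] [DecidableEq O]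

/-- The map on operators with Choi matrix `T`. -/
def choiMap (T : Matrix (A × A) (A × A) ℂ) : Matrix A A ℂ →ₗ[ℂ] Matrix A A ℂ where
  toFun M := Matrix.of fun a a' => ∑ b, ∑ b', T (a, b) (a', b') * M b b'
  map_add' M N := by
    ext a a'
    simp [mul_add, Finset.sum_add_distrib]
  map_smul' c M := by
    ext a a'
    simp [Finset.mul_sum, mul_left_comm]

/-- The Choi matrices of channels. -/
def choiMatrices (A : Type*) [Fintype A] [DecidableEq A] : Set (Matrix (A × A) (A × A) ℂ) :=
  {T | T.PosSemidef ∧ traceFst T = 1}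

theorem exists_gram {n : Type*} [Fintype n] [DecidableEq n] {M : Matrix n n ℂ}
    (hM : M.PosSemidef) : ∃ Z : Matrix n n ℂ, ∀ x y, M x y = ∑ z, star (Z z x) * Z z y := by
  obtain ⟨Z, rfl⟩ := CStarAlgebra.nonneg_iff_eq_star_mul_self.mp
    (Matrix.nonneg_iff_posSemidef.mpr hM)
  exact ⟨Z, fun x y => by simp [Matrix.mul_apply, Matrix.star_eq_conjTranspose]⟩

/-- A Gram factorization of the Choi matrix supplies Kraus operators, hence complete positivity; the
partial trace over the output factor encodes trace preservation. -/
theorem isChannel_choiMap {T : Matrix (A × A) (A × A) ℂ} (hT : T ∈ choiMatrices A) :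
    IsChannel (choiMap T) := by
  obtain ⟨hT, h1⟩ := hT
  constructor
  · intro M
    have h2 : ∀ b b', ∑ a, T (a, b) (a, b') = if b = b' then 1 else 0 := fun b b' => by
      have := congrFun (congrFun h1 b) b'
      simpa [traceFst, Matrix.one_apply] using this
    have h3 : (choiMap T M).trace = ∑ b, ∑ b', (∑ a, T (a, b) (a, b')) * M b b' := by
      simp only [Matrix.trace, Matrix.diag, choiMap, LinearMap.coe_mk, AddHom.coe_mk,
        Matrix.of_apply, Finset.sum_mul]
      rw [Finset.sum_comm]
      exact Finset.sum_congr rfl fun b _ => Finset.sum_comm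
    rw [h3]
    simp [h2, Matrix.trace]
  · intro n M hM
    obtain ⟨Z, hZ⟩ := exists_gram hT
    have e : ampliation (Fin n) (choiMap T) M =
        ∑ z, ((Matrix.of fun a b => star (Z z (a, b))) ⊗ₖ (1 : Matrix (Fin n) (Fin n) ℂ)) * M *
          ((Matrix.of fun a b => star (Z z (a, b))) ⊗ₖ (1 : Matrix (Fin n) (Fin n) ℂ))ᴴ := by
      ext ⟨a, i⟩ ⟨a', j⟩
      rw [Matrix.sum_apply]
      simp only [ampliation, choiMap, LinearMap.coe_mk, AddHom.coe_mk, Matrix.of_apply, hZ,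
        Matrix.mul_apply, Fintype.sum_prod_type (α₁ := A) (α₂ := Fin n), Matrix.kroneckerMap_apply, Matrix.one_apply,
        Matrix.conjTranspose_apply, Finset.sum_mul, star_star, apply_ite star, star_zero,
        mul_ite, mul_one, mul_zero, ite_mul, zero_mul, Finset.sum_ite_eq,
        Finset.mem_univ, if_true]
      rw [Finset.sum_congr rfl fun b _ => Finset.sum_comm, Finset.sum_comm]
      refine Finset.sum_congr rfl fun z _ => ?_
      rw [Finset.sum_comm]
      refine Finset.sum_congr rfl fun b _ => Finset.sum_congr rfl fun b' _ => ?_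
      ring
    rw [e]
    exact Matrix.posSemidef_sum _ fun z _ => hM.mul_mul_conjTranspose_same _

/-- The Choi matrix of the identity channel; it serves as a default whenever some channel, no matter
which, is needed. -/
theorem idChoi_mem : proj (fun p : A × A => if p.1 = p.2 then (1 : ℂ) else 0) ∈ choiMatrices A := by
  refine ⟨Matrix.posSemidef_vecMulVec_self_star _, ?_⟩
  ext b b'
  simp [traceFst, proj, Matrix.vecMulVec_apply, Matrix.one_apply, eq_comm]

theorem norm_apply_le_trace {n : Type*} [Fintype n] [DecidableEq n] {M : Matrix n n ℂ}
    (hM : M.PosSemidef) (x y : n) : ‖M x y‖ ≤ M.trace.re := by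
  obtain ⟨Z, hZ⟩ := exists_gram hM
  have h1 : M.trace.re = ∑ z, ∑ x, ‖Z z x‖ ^ 2 := by
    rw [Finset.sum_comm]
    simp only [Matrix.trace, Matrix.diag, hZ, Complex.re_sum]
    refine Finset.sum_congr rfl fun x _ => Finset.sum_congr rfl fun z _ => ?_
    rw [← Complex.normSq_eq_norm_sq]
    simp [Complex.normSq_apply]
  rw [h1, hZ]
  refine (norm_sum_le _ _).trans (Finset.sum_le_sum fun z _ => ?_)
  have hx := Finset.single_le_sum (f := fun x => ‖Z z x‖ ^ 2) (fun _ _ => by positivity)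
    (Finset.mem_univ x)
  have hy := Finset.single_le_sum (f := fun x => ‖Z z x‖ ^ 2) (fun _ _ => by positivity)
    (Finset.mem_univ y)
  rw [norm_mul, norm_star]
  nlinarith [sq_nonneg (‖Z z x‖ - ‖Z z y‖)]

theorem isClosed_posSemidef {n : Type*} [Fintype n] [DecidableEq n] :
    IsClosed {M : Matrix n n ℂ | M.PosSemidef} := by
  simp only [Matrix.posSemidef_iff_dotProduct_mulVec, Set.ofPred_and, Set.ofPred_forall]
  refine IsClosed.inter ?_ (isClosed_iInter fun v => ?_)
  · exact isClosed_eq (by fun_prop) continuous_id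
  · exact isClosed_le continuous_const (by fun_prop)

theorem isCompact_posSemidef_trace {n : Type*} [Fintype n] [DecidableEq n] (c : ℂ) :
    IsCompact {M : Matrix n n ℂ | M.PosSemidef ∧ M.trace = c} := by
  have hK : IsCompact (Set.pi Set.univ fun _ : n => Set.pi Set.univ fun _ : n =>
      Metric.closedBall (0 : ℂ) c.re) :=
    isCompact_univ_pi fun _ => isCompact_univ_pi fun _ => isCompact_closedBall _ _
  refine hK.of_isClosed_subset ?_ ?_
  · exact isClosed_posSemidef.inter (isClosed_eq (by fun_prop) continuous_const)
  · rintro M ⟨hM, rfl⟩ x - y -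
    simpa using norm_apply_le_trace hM x y

theorem isCompact_choiMatrices : IsCompact (choiMatrices A) := by
  refine (isCompact_posSemidef_trace (n := A × A) (Fintype.card A)).of_isClosed_subset ?_ ?_
  · refine isClosed_posSemidef.inter (isClosed_eq ?_ continuous_const)
    unfold traceFst
    fun_prop
  · rintro T ⟨hT, h1⟩
    refine ⟨hT, ?_⟩
    have h2 : T.trace = (traceFst T).trace := by
      simp only [Matrix.trace, Matrix.diag, traceFst, Matrix.of_apply, Fintype.sum_prod_type]
      exact Finset.sum_comm
    rw [h2, h1, Matrix.trace_one]

theorem convex_choiMatrices : Convex ℝ (choiMatrices A) := by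
  rintro S ⟨hS, hS1⟩ T ⟨hT, hT1⟩ a b ha hb hab
  refine ⟨(hS.smul ha).add (hT.smul hb), ?_⟩
  have e : traceFst (a • S + b • T) = a • traceFst S + b • traceFst T := by
    ext
    simp [traceFst, Finset.sum_add_distrib, Finset.smul_sum]
  rw [e, hS1, hT1, ← add_smul, hab, one_smul]

theorem isCompact_codeStates (C : Submodule ℂ (A → ℂ)) : IsCompact (codeStates C) := by
  refine (isCompact_posSemidef_trace (n := A) 1).of_isClosed_subset ?_ fun ρ hρ => hρ.1
  have e : codeStates C = {ρ : Matrix A A ℂ | ρ.PosSemidef} ∩ {ρ | ρ.trace = 1} ∩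
      ⋂ v : A → ℂ, {ρ : Matrix A A ℂ | ρ *ᵥ v ∈ C} := by
    ext ρ
    simp only [codeStates, IsState, Set.mem_ofPred_eq, Set.mem_inter_iff, Set.mem_iInter]
    refine and_congr_right fun _ => ⟨fun h v => h ⟨v, rfl⟩, ?_⟩
    rintro h _ ⟨v, rfl⟩
    exact h v
  rw [e]
  refine (isClosed_posSemidef.inter (isClosed_eq (by fun_prop) continuous_const)).inter
    (isClosed_iInter fun v => ?_)
  exact C.closed_of_finiteDimensional.preimage (f := fun ρ : Matrix A A ℂ => ρ *ᵥ v) (by fun_prop)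

theorem convex_codeStates (C : Submodule ℂ (A → ℂ)) : Convex ℝ (codeStates C) := by
  rintro ρ ⟨⟨hρ, tρ⟩, cρ⟩ τ ⟨⟨hτ, tτ⟩, cτ⟩ a b ha hb hab
  refine ⟨⟨(hρ.smul ha).add (hτ.smul hb), ?_⟩, ?_⟩
  · rw [Matrix.trace_add, Matrix.trace_smul, Matrix.trace_smul, tρ, tτ, ← add_smul, hab, one_smul]
  · rintro _ ⟨v, rfl⟩
    have e : (a • ρ + b • τ).mulVecLin v = (a : ℂ) • (ρ *ᵥ v) + (b : ℂ) • (τ *ᵥ v) := by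
      rw [Matrix.mulVecLin_apply, Matrix.add_mulVec, Matrix.smul_mulVec, Matrix.smul_mulVec]
      rfl
    rw [e]
    exact C.add_mem (C.smul_mem _ (cρ ⟨v, rfl⟩)) (C.smul_mem _ (cτ ⟨v, rfl⟩))

/-- The sesquilinear form with matrix `T`, transposed. -/
def form {n : Type*} [Fintype n] (T : Matrix n n ℂ) (v w : n → ℂ) : ℝ :=
  (∑ x, ∑ y, T x y * (v x * star (w y))).re

/-- The square of the entanglement fidelity, for the state `ρ`, of the noise with dilation `J`
followed by the recovery map with Choi matrix `T`. -/
def fidelitySq (J : Matrix (O × A) A ℂ) (T : Matrix (A × A) (A × A) ℂ) (ρ : Matrix A A ℂ) : ℝ :=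
  ∑ o, form T (fun x => (J * ρ) (o, x.2) x.1) fun x => (J * ρ) (o, x.2) x.1

theorem form_self_nonneg {n : Type*} [Fintype n] {T : Matrix n n ℂ} (hT : T.PosSemidef)
    (v : n → ℂ) : 0 ≤ form T v v := by
  have h := (Complex.le_def.mp (hT.dotProduct_mulVec_nonneg (star v))).1
  refine h.trans_eq (congrArg Complex.re ?_)
  simp only [dotProduct, Matrix.mulVec, Pi.star_apply, star_star, Finset.mul_sum]
  exact Finset.sum_congr rfl fun x _ => Finset.sum_congr rfl fun y _ => by ring

/-- The gap between the two sides is `a b` times the form at `v - w`, which is nonnegative. -/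
theorem form_convex {n : Type*} [Fintype n] {T : Matrix n n ℂ} (hT : T.PosSemidef)
    (v w : n → ℂ) {a b : ℝ} (ha : 0 ≤ a) (hb : 0 ≤ b) (hab : a + b = 1) :
    form T (a • v + b • w) (a • v + b • w) ≤ a * form T v v + b * form T w w := by
  have e1 : ∀ c d : ℝ, form T (c • v + d • w) (c • v + d • w) =
      c * c * form T v v + c * d * (form T v w + form T w v) + d * d * form T w w := by
    intro c d
    simp only [form, ← Complex.add_re, ← Complex.re_ofReal_mul]
    congr 1
    simp only [Finset.mul_sum, ← Finset.sum_add_distrib]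
    refine Finset.sum_congr rfl fun x _ => Finset.sum_congr rfl fun y _ => ?_
    simp only [Pi.add_apply, Pi.smul_apply, Complex.real_smul, star_add, star_mul',
      Complex.star_def, Complex.conj_ofReal]
    push_cast
    ring
  have h := form_self_nonneg hT ((1 : ℝ) • v + (-1 : ℝ) • w)
  rw [e1] at h ⊢
  have hb' : b = 1 - a := by linarith
  subst hb'
  nlinarith [mul_nonneg ha hb]

theorem convexOn_fidelitySq (J : Matrix (O × A) A ℂ) {T : Matrix (A × A) (A × A) ℂ}
    (hT : T.PosSemidef) {X : Set (Matrix A A ℂ)} (hX : Convex ℝ X) :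
    ConvexOn ℝ X fun ρ => fidelitySq J T ρ := by
  refine ⟨hX, fun ρ _ τ _ a b ha hb hab => ?_⟩
  simp only [fidelitySq, smul_eq_mul, Finset.mul_sum, ← Finset.sum_add_distrib]
  refine Finset.sum_le_sum fun o _ => ?_
  refine le_of_eq_of_le ?_ (form_convex hT _ _ ha hb hab)
  congr 1 <;> · ext x; simp [Matrix.mul_add]

theorem concaveOn_fidelitySq (J : Matrix (O × A) A ℂ) (ρ : Matrix A A ℂ)
    {Y : Set (Matrix (A × A) (A × A) ℂ)} (hY : Convex ℝ Y) :
    ConcaveOn ℝ Y fun T => fidelitySq J T ρ := by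
  refine ⟨hY, fun S _ T _ a b ha hb hab => le_of_eq ?_⟩
  simp only [fidelitySq, form, smul_eq_mul, Finset.mul_sum, ← Finset.sum_add_distrib,
    Complex.re_sum]
  refine Finset.sum_congr rfl fun o _ => Finset.sum_congr rfl fun x _ =>
    Finset.sum_congr rfl fun y _ => ?_
  simp only [Matrix.add_apply, Matrix.smul_apply, add_mul, smul_mul_assoc, Complex.add_re,
    Complex.smul_re, smul_eq_mul]

/-- If each code state can be recovered up to squared fidelity `c`, then a single recovery channel
does so for all of them. -/
theorem exists_recovery_of_forall (J : Matrix (O × A) A ℂ) (C : Submodule ℂ (A → ℂ)) (c : ℝ)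
    (h : ∀ ρ ∈ codeStates C, ∃ T ∈ choiMatrices A, c ≤ fidelitySq J T ρ) :
    ∃ T ∈ choiMatrices A, ∀ ρ ∈ codeStates C, c ≤ fidelitySq J T ρ := by
  rcases (codeStates C).eq_empty_or_nonempty with h0 | h0
  · exact ⟨_, idChoi_mem, by simp [h0]⟩
  -- At a saddle point `(ρ, T)`, every recovery of the worst state `ρ` does no better on `ρ` than
  -- `T` does on any code state. Working with the square of the fidelity makes the function
  -- quadratic in the state and affine in the recovery.
  obtain ⟨ρ, hρ, T, hT, hs⟩ := Sion.exists_isSaddlePointOn h0 (convex_codeStates C)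
    (isCompact_codeStates C) (f := fun ρ T => fidelitySq J T ρ)
    (fun T hT => ContinuousOn.lowerSemicontinuousOn
      (Continuous.continuousOn <| by unfold fidelitySq form; fun_prop))
    (fun T hT => (convexOn_fidelitySq J hT.1 (convex_codeStates C)).quasiconvexOn)
    convex_choiMatrices ⟨_, idChoi_mem⟩ isCompact_choiMatrices
    (fun ρ hρ => ContinuousOn.upperSemicontinuousOn
      (Continuous.continuousOn <| by unfold fidelitySq form; fun_prop))
    (fun ρ hρ => (concaveOn_fidelitySq J ρ convex_choiMatrices).quasiconcaveOn)
  obtain ⟨S, hS, hc⟩ := h ρ hρ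
  exact ⟨T, hT, fun τ hτ => hc.trans (hs τ hτ S hS)⟩

end Recovery

/-! ### Entanglement fidelity as an expectation value, and recovery by Uhlmann's argument -/

section Uhlmann

variable {A O B : Type*} [Fintype A] [DecidableEq A] [Fintype O] [DecidableEq O]
  [Fintype B] [DecidableEq B]

theorem form_self_ofReal {n : Type*} [Fintype n] {T : Matrix n n ℂ} (hT : T.PosSemidef)
    (v : n → ℂ) : ∑ x, ∑ y, T x y * (v x * star (v y)) = (form T v v : ℂ) := by
  have h := (Complex.le_def.mp (hT.dotProduct_mulVec_nonneg (star v))).2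
  have e : star (star v) ⬝ᵥ T *ᵥ star v = ∑ x, ∑ y, T x y * (v x * star (v y)) := by
    simp only [dotProduct, Matrix.mulVec, Pi.star_apply, star_star, Finset.mul_sum]
    exact Finset.sum_congr rfl fun x _ => Finset.sum_congr rfl fun y _ => by ring
  rw [e] at h
  exact Complex.ext rfl h.symm

theorem proj_mul_mul_proj {n : Type*} [Fintype n] (M : Matrix n n ℂ) (φ : n → ℂ) :
    proj φ * M * proj φ = (star φ ⬝ᵥ M *ᵥ φ) • proj φ := by
  unfold proj
  rw [Matrix.vecMulVec_mul, Matrix.vecMulVec_mul_vecMulVec, ← Matrix.dotProduct_mulVec]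
  ext i j
  simp [Matrix.vecMulVec_apply]
  ring

theorem star_dotProduct_self {n : Type*} [Fintype n] (φ : n → ℂ) :
    star φ ⬝ᵥ φ = ((∑ a, ‖φ a‖ ^ 2 : ℝ) : ℂ) := by
  simp [dotProduct, ← Complex.normSq_eq_norm_sq, Complex.normSq_eq_conj_mul_self]

/-- The fidelity with a pure state. -/
theorem fidelity_proj {n : Type*} [Fintype n] [DecidableEq n] (M : Matrix n n ℂ) {φ : n → ℂ}
    (hφ : IsUnitVec φ) {r : ℝ} (hr : 0 ≤ r) (hM : star φ ⬝ᵥ M *ᵥ φ = r) :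
    fidelity M (proj φ) = √r := by
  have hp : (proj φ).PosSemidef := Matrix.posSemidef_vecMulVec_self_star φ
  have h1 : star φ ⬝ᵥ φ = 1 := by
    rw [star_dotProduct_self, show ∑ a, ‖φ a‖ ^ 2 = 1 from hφ, Complex.ofReal_one]
  have hpp : proj φ * proj φ = proj φ := by
    have h := proj_mul_mul_proj 1 φ
    rwa [Matrix.mul_one, Matrix.one_mulVec, h1, one_smul] at h
  have hs : CFC.sqrt (proj φ) = proj φ :=
    (CFC.sqrt_eq_iff _ _ (Matrix.nonneg_iff_posSemidef.mpr hp)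
      (Matrix.nonneg_iff_posSemidef.mpr hp)).mpr hpp
  have hs2 : CFC.sqrt ((r : ℂ) • proj φ) = ((√r : ℝ) : ℂ) • proj φ := by
    rw [CFC.sqrt_eq_iff _ _ (Matrix.nonneg_iff_posSemidef.mpr (hp.smul (by exact_mod_cast hr)))
      (Matrix.nonneg_iff_posSemidef.mpr (hp.smul (by exact_mod_cast Real.sqrt_nonneg r))),
      Matrix.smul_mul, Matrix.mul_smul, smul_smul, hpp, ← Complex.ofReal_mul,
      Real.mul_self_sqrt hr]
  have ht : (proj φ).trace = 1 := by
    rw [proj, Matrix.trace_vecMulVec, dotProduct_comm, h1]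
  rw [fidelity, hs, proj_mul_mul_proj, hM, hs2, Matrix.trace_smul, ht]
  simp

/-- The expectation of `choiMap T ∘ N` in a purification `φ` of `ρ`. -/
theorem expectation_choiMap {J : Matrix (O × A) A ℂ} {N : Matrix A A ℂ →ₗ[ℂ] Matrix A A ℂ}
    (hN : ∀ M, N M = traceFst (J * M * Jᴴ)) (T : Matrix (A × A) (A × A) ℂ) {ρ : Matrix A A ℂ}
    {φ : A × B → ℂ} (hφ : IsPurification φ ρ) :
    star φ ⬝ᵥ (ampliation B (choiMap T ∘ₗ N) (proj φ)) *ᵥ φ =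
      ∑ o, ∑ x, ∑ y, T x y * ((J * ρ) (o, x.2) x.1 * star ((J * ρ) (o, y.2) y.1)) := by
  set G : O → A → B → ℂ := fun o b r => ∑ c, J (o, b) c * φ (c, r) with hG
  -- Contracting the reference system of `(J ⊗ 1) φ` with that of `φ` leaves `J ρ`; this is why the
  -- result depends on `φ` only through `ρ`.
  have hu : ∀ o b a, (J * ρ) (o, b) a = ∑ r, G o b r * star (φ (a, r)) := by
    intro o b a
    rw [Matrix.mul_apply, ← hφ]
    simp only [traceSnd, proj, Matrix.of_apply, Matrix.vecMulVec_apply, Pi.star_apply, hG,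
      Finset.mul_sum, Finset.sum_mul]
    rw [Finset.sum_comm]
    simp only [mul_assoc]
  have hn : ∀ r r' b b', N (Matrix.of fun a a' => proj φ (a, r) (a', r')) b b' =
      ∑ o, G o b r * star (G o b' r') := by
    intro r r' b b'
    rw [hN]
    simp only [traceFst, Matrix.of_apply, Matrix.mul_apply, Matrix.conjTranspose_apply, proj,
      Matrix.vecMulVec_apply, Pi.star_apply, hG, star_sum, Finset.mul_sum, Finset.sum_mul, star_mul']
    refine Finset.sum_congr rfl fun o _ => Finset.sum_congr rfl fun c _ =>
      Finset.sum_congr rfl fun c' _ => ?_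
    ring
  have hl : star φ ⬝ᵥ (ampliation B (choiMap T ∘ₗ N) (proj φ)) *ᵥ φ =
      ∑ a, ∑ r, ∑ a', ∑ r', ∑ b, ∑ b', ∑ o, T (a, b) (a', b') *
        ((G o b r * star (φ (a, r))) * (star (G o b' r') * φ (a', r'))) := by
    simp only [dotProduct, Matrix.mulVec, Fintype.sum_prod_type, ampliation, choiMap,
      LinearMap.coe_mk, AddHom.coe_mk, Matrix.of_apply, LinearMap.comp_apply, hn, Pi.star_apply,
      Finset.mul_sum, Finset.sum_mul]
    refine Finset.sum_congr rfl fun a _ => Finset.sum_congr rfl fun r _ =>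
      Finset.sum_congr rfl fun a' _ => Finset.sum_congr rfl fun r' _ =>
      Finset.sum_congr rfl fun b _ => Finset.sum_congr rfl fun b' _ =>
      Finset.sum_congr rfl fun o _ => ?_
    ring
  have hrr : ∑ o, ∑ x : A × A, ∑ y : A × A,
      T x y * ((J * ρ) (o, x.2) x.1 * star ((J * ρ) (o, y.2) y.1)) =
      ∑ o, ∑ a, ∑ b, ∑ a', ∑ b', ∑ r, ∑ r', T (a, b) (a', b') *
        ((G o b r * star (φ (a, r))) * (star (G o b' r') * φ (a', r'))) := by
    simp only [Fintype.sum_prod_type, hu, star_sum, star_mul', star_star, Finset.mul_sum,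
      Finset.sum_mul]
    refine Finset.sum_congr rfl fun o _ => Finset.sum_congr rfl fun a _ =>
      Finset.sum_congr rfl fun b _ => Finset.sum_congr rfl fun a' _ =>
      Finset.sum_congr rfl fun b' _ => Finset.sum_comm
  rw [hl, hrr]
  simp only [← Finset.sum_product']
  refine Finset.sum_nbij' (fun ⟨a, r, a', r', b, b', o⟩ => (o, a, b, a', b', r, r'))
    (fun ⟨o, a, b, a', b', r, r'⟩ => (a, r, a', r', b, b', o)) ?_ ?_ ?_ ?_ ?_ <;> simp

theorem isUnitVec_of_isPurification {φ : A × B → ℂ} {ρ : Matrix A A ℂ} (h : IsPurification φ ρ)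
    (hρ : ρ.trace = 1) : IsUnitVec φ := by
  have e : ρ.trace = star φ ⬝ᵥ φ := by
    rw [← h]
    simp only [Matrix.trace, Matrix.diag, traceSnd, proj, Matrix.of_apply, Matrix.vecMulVec_apply,
      dotProduct, Fintype.sum_prod_type, Pi.star_apply, mul_comm]
  rw [star_dotProduct_self, hρ] at e
  exact Complex.ofReal_injective (e.symm.trans Complex.ofReal_one.symm)

/-- The identity leaves the purification pure, and fidelity with a pure state is the root of an
expectation value. -/
theorem entanglementFidelity_choiMap {J : Matrix (O × A) A ℂ}
    {N : Matrix A A ℂ →ₗ[ℂ] Matrix A A ℂ} (hN : ∀ M, N M = traceFst (J * M * Jᴴ))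
    {T : Matrix (A × A) (A × A) ℂ} (hT : T.PosSemidef) {ρ : Matrix A A ℂ} (hρ : IsState ρ) :
    entanglementFidelity (choiMap T ∘ₗ N) LinearMap.id ρ = √(fidelitySq J T ρ) := by
  have hφ := isPurification_canonicalPurification hρ.1
  have hid : ampliation A (LinearMap.id : Matrix A A ℂ →ₗ[ℂ] Matrix A A ℂ)
      (proj (canonicalPurification ρ)) = proj (canonicalPurification ρ) := rfl
  rw [entanglementFidelity, hid]
  refine fidelity_proj _ (isUnitVec_of_isPurification hφ hρ.2)
    (Finset.sum_nonneg fun o _ => form_self_nonneg hT _) ?_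
  rw [expectation_choiMap hN T hφ, fidelitySq, Complex.ofReal_sum]
  exact Finset.sum_congr rfl fun o _ => form_self_ofReal hT _

/-- The Choi matrix of `M ↦ Tr_O (W M Wᴴ)`. -/
def krausChoi (W : Matrix (O × A) A ℂ) : Matrix (A × A) (A × A) ℂ :=
  ∑ o, proj fun x : A × A => W (o, x.1) x.2

theorem traceFst_krausChoi (W : Matrix (O × A) A ℂ) : traceFst (krausChoi W) = (Wᴴ * W)ᵀ := by
  ext b b'
  simp only [traceFst, krausChoi, Matrix.of_apply, Matrix.sum_apply, proj, Matrix.vecMulVec_apply,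
    Pi.star_apply, Matrix.transpose_apply, Matrix.mul_apply, Matrix.conjTranspose_apply,
    Fintype.sum_prod_type]
  rw [Finset.sum_comm]
  simp only [mul_comm]

/-- A contraction only gives a trace-nonincreasing map. The added term prepares `ρ` with the missing
weight `1 - Wᴴ W`; being positive, it cannot lower the fidelity. -/
theorem krausChoi_add_mem {W : Matrix (O × A) A ℂ} (hW : IsContraction W) {ρ : Matrix A A ℂ}
    (hρ : IsState ρ) : krausChoi W + ρ ⊗ₖ (1 - Wᴴ * W)ᵀ ∈ choiMatrices A := by
  refine ⟨(Matrix.posSemidef_sum _ fun o _ => Matrix.posSemidef_vecMulVec_self_star _).add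
    (hρ.1.kronecker (Matrix.PosSemidef.transpose hW)), ?_⟩
  have h1 : traceFst (krausChoi W + ρ ⊗ₖ (1 - Wᴴ * W)ᵀ) =
      traceFst (krausChoi W) + ρ.trace • (1 - Wᴴ * W)ᵀ := by
    ext b b'
    simp [traceFst, Finset.sum_add_distrib, Matrix.trace, Finset.sum_mul]
  rw [h1, traceFst_krausChoi, hρ.2, one_smul, ← Matrix.transpose_add, add_sub_cancel,
    Matrix.transpose_one]

theorem form_add {n : Type*} [Fintype n] (S T : Matrix n n ℂ) (v w : n → ℂ) :
    form (S + T) v w = form S v w + form T v w := by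
  simp [form, add_mul, Finset.sum_add_distrib]

theorem form_krausChoi (W : Matrix (O × A) A ℂ) (v : A × A → ℂ) :
    form (krausChoi W) v v = ∑ o, ‖∑ x : A × A, W (o, x.1) x.2 * v x‖ ^ 2 := by
  have h : ∀ o, ‖∑ x : A × A, W (o, x.1) x.2 * v x‖ ^ 2 =
      (∑ x : A × A, ∑ y : A × A,
        W (o, x.1) x.2 * star (W (o, y.1) y.2) * (v x * star (v y))).re := by
    intro o
    rw [← Complex.normSq_eq_norm_sq, ← Complex.ofReal_re (Complex.normSq _), ← Complex.mul_conj,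
      map_sum, Finset.sum_mul_sum]
    refine congrArg _ (Finset.sum_congr rfl fun x _ => Finset.sum_congr rfl fun y _ => ?_)
    rw [map_mul]
    simp only [Complex.star_def]
    ring
  simp only [h, form, ← Complex.re_sum]
  simp only [krausChoi, Matrix.sum_apply, proj, Matrix.vecMulVec_apply, Pi.star_apply,
    Finset.sum_mul]
  exact congrArg _ ((Finset.sum_congr rfl fun x _ => Finset.sum_comm).trans Finset.sum_comm)

/-- The matrix of the vector obtained by applying the dilation `J` to the vector with
matrix `ψ`. -/
def evolveMatrix (J : Matrix (O × A) A ℂ) (ψ : Matrix A B ℂ) : Matrix (O × B) A ℂ :=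
  Matrix.of fun p a => (J * ψ) (p.1, a) p.2

/-- Recovery of the state `ψ ψᴴ` by the contraction that comes from Uhlmann's theorem, when the
reduced state on `O ⊗ B` is compared with a product state. -/
theorem exists_recovery_sqrt (J : Matrix (O × A) A ℂ) {ψ : Matrix A B ℂ}
    (hψ : IsState (ψ * ψᴴ)) {S : Matrix O O ℂ} (hS : IsState S) :
    ∃ T ∈ choiMatrices A,
      (CFC.sqrt (evolveMatrix J ψ * (evolveMatrix J ψ)ᴴ) *
        CFC.sqrt (S ⊗ₖ (ψᵀ * ψᵀᴴ))).trace.re ^ 2 ≤ fidelitySq J T (ψ * ψᴴ) := by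
  set χ := evolveMatrix J ψ with hχ
  -- The matrix of the purification `√S ⊗ ψ` of the product state, with `O ⊗ A` as purifying system.
  set Y : Matrix (O × B) (O × A) ℂ := CFC.sqrt S ⊗ₖ ψᵀ with hY
  have eY : Y * Yᴴ = S ⊗ₖ (ψᵀ * ψᵀᴴ) := by
    rw [hY, Matrix.conjTranspose_kronecker, ← Matrix.mul_kronecker_mul, conjTranspose_sqrt,
      sqrt_mul_sqrt hS.1]
  obtain ⟨V₁, hV₁, e₁⟩ := exists_polar χ
  obtain ⟨V₂, hV₂, e₂⟩ := exists_polar Y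
  -- Combining the polar parts of `χ` and `Y` aligns the two purifications, so that `Tr (χ Wᵀ Yᴴ)`
  -- is the trace of the product of the two square roots.
  set W : Matrix (O × A) A ℂ := (V₁ᴴ * V₂)ᵀ with hW
  have cW : IsContraction W := (hV₁.conjTranspose.mul hV₂).transpose
  refine ⟨_, krausChoi_add_mem cW hψ, ?_⟩
  -- The overlap of the recovered vector with the original one, when the noise environment is in
  -- state `o` and the discarded register of the recovery in state `o'`.
  set z : O → O → ℂ := fun o o' =>
    ∑ x : A × A, W (o', x.1) x.2 * (J * (ψ * ψᴴ)) (o, x.2) x.1 with hz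
  have hf : ∑ o, ∑ o', ‖z o o'‖ ^ 2 ≤
      fidelitySq J (krausChoi W + (ψ * ψᴴ) ⊗ₖ (1 - Wᴴ * W)ᵀ) (ψ * ψᴴ) := by
    unfold fidelitySq
    refine Finset.sum_le_sum fun o _ => ?_
    rw [form_add, form_krausChoi]
    exact le_add_of_nonneg_right (form_self_nonneg
      (hψ.1.kronecker (Matrix.PosSemidef.transpose cW)) _)
  have ht : (CFC.sqrt (χ * χᴴ) * CFC.sqrt (S ⊗ₖ (ψᵀ * ψᵀᴴ))).trace =
      ∑ o, ∑ o', star (CFC.sqrt S o o') * z o o' := by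
    have h1 : CFC.sqrt (χ * χᴴ) * CFC.sqrt (S ⊗ₖ (ψᵀ * ψᵀᴴ)) = χ * (Wᵀ * Yᴴ) := by
      rw [← conjTranspose_sqrt (S ⊗ₖ _), ← eY, ← e₂, ← e₁, hW]
      simp only [Matrix.conjTranspose_mul, Matrix.conjTranspose_conjTranspose, Matrix.mul_assoc,
        Matrix.transpose_transpose]
    have h2 : ∀ o c a, (J * (ψ * ψᴴ)) (o, c) a = ∑ b, χ (o, b) c * star (ψ a b) := by
      intro o c a
      rw [← Matrix.mul_assoc, Matrix.mul_apply]
      rfl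
    rw [h1]
    simp only [Matrix.trace, Matrix.diag, Matrix.mul_apply (M := χ), Matrix.mul_apply (M := Wᵀ),
      Matrix.transpose_apply, Matrix.conjTranspose_apply, hY, Matrix.kroneckerMap_apply, hz, h2,
      Fintype.sum_prod_type, Finset.mul_sum, star_mul']
    refine Finset.sum_congr rfl fun o _ => ?_
    simp only [← Finset.sum_product']
    refine Finset.sum_nbij' (fun ⟨b, c, o', a⟩ => (o', a, c, b))
      (fun ⟨o', a, c, b⟩ => (b, c, o', a)) ?_ ?_ ?_ ?_ ?_ <;> simp
    intros
    ring
  have hs : ∑ o, ∑ o', ‖CFC.sqrt S o o'‖ ^ 2 = 1 := by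
    have h : (S.trace : ℂ) = ((∑ o, ∑ o', ‖CFC.sqrt S o o'‖ ^ 2 : ℝ) : ℂ) := by
      conv_lhs => rw [← sqrt_mul_sqrt hS.1]
      nth_rewrite 2 [← conjTranspose_sqrt]
      simp only [Matrix.trace, Matrix.diag, Matrix.mul_apply, Matrix.conjTranspose_apply,
        Complex.ofReal_sum, ← Complex.normSq_eq_norm_sq, Complex.star_def, Complex.mul_conj]
    rw [hS.2] at h
    exact_mod_cast h.symm
  -- The trace is the inner product of the array `z` with `√S`, whose Hilbert–Schmidt norm is `1`
  -- because `S` has unit trace; Cauchy–Schwarz concludes.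
  refine le_trans ?_ hf
  rw [ht]
  simp only [← Fintype.sum_prod_type'] at hs ⊢
  set Z := ∑ x : O × O, star (CFC.sqrt S x.1 x.2) * z x.1 x.2 with hZ
  calc Z.re ^ 2 ≤ ‖Z‖ ^ 2 := by
        rw [← sq_abs]
        exact pow_le_pow_left₀ (abs_nonneg _) (Complex.abs_re_le_norm Z) 2
    _ ≤ (∑ x : O × O, ‖CFC.sqrt S x.1 x.2‖ * ‖z x.1 x.2‖) ^ 2 := by
        refine pow_le_pow_left₀ (norm_nonneg _) ((norm_sum_le _ _).trans_eq ?_) 2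
        simp only [norm_mul, norm_star]
    _ ≤ (∑ x : O × O, ‖CFC.sqrt S x.1 x.2‖ ^ 2) * ∑ x : O × O, ‖z x.1 x.2‖ ^ 2 :=
        Finset.sum_mul_sq_le_sq_mul_sq _ _ _
    _ = ∑ x : O × O, ‖z x.1 x.2‖ ^ 2 := by rw [hs, one_mul]

end Uhlmann

/-! ### Decoupling and correctability -/

section Decoupling

variable {A O B E H : Type*} [Fintype A] [DecidableEq A] [Fintype O] [DecidableEq O]
  [Fintype B] [DecidableEq B] [Fintype E] [DecidableEq E] [Fintype H] [DecidableEq H]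

theorem isCorrectable_of_forall {J : Matrix (O × A) A ℂ} {N : Matrix A A ℂ →ₗ[ℂ] Matrix A A ℂ}
    (hN : ∀ M, N M = traceFst (J * M * Jᴴ)) (C : Submodule ℂ (A → ℂ)) {δ : ℝ}
    (h : ∀ ρ ∈ codeStates C, ∃ T ∈ choiMatrices A, ∃ x : ℝ, 1 - δ / 2 ≤ x ∧
      x ^ 2 ≤ fidelitySq J T ρ) : IsCorrectable C N √(δ / 2) := by
  obtain ⟨T, hT, hTρ⟩ : ∃ T ∈ choiMatrices A, ∀ ρ ∈ codeStates C,
      1 - δ / 2 ≤ √(fidelitySq J T ρ) := by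
    -- A bound can be squared only if it is nonnegative; otherwise the fidelity bound is void and
    -- any channel will do.
    rcases le_total (1 - δ / 2) 0 with hδ | hδ
    · exact ⟨_, idChoi_mem, fun ρ _ => hδ.trans (Real.sqrt_nonneg _)⟩
    · obtain ⟨T, hT, hc⟩ := exists_recovery_of_forall J C ((1 - δ / 2) ^ 2) fun ρ hρ => by
        obtain ⟨T, hT, x, hx, hxT⟩ := h ρ hρ
        exact ⟨T, hT, (pow_le_pow_left₀ hδ hx 2).trans hxT⟩
      exact ⟨T, hT, fun ρ hρ => Real.le_sqrt_of_sq_le (hc ρ hρ)⟩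
  refine ⟨choiMap T, isChannel_choiMap hT, Real.sSup_le ?_ (Real.sqrt_nonneg _)⟩
  rintro _ ⟨ρ, hρ, rfl⟩
  refine Real.sqrt_le_sqrt ?_
  rw [entanglementFidelity_choiMap hN hT.1 hρ.1]
  linarith [hTρ ρ hρ]

/-- A state supported on the range of `V : B → A` has a purification by `B` of the form `V K`. -/
theorem exists_eq_mul_sqrt {V : Matrix A B ℂ} {ρ : Matrix A A ℂ} (hρ : ρ.PosSemidef)
    (hV : LinearMap.range ρ.mulVecLin ≤ LinearMap.range V.mulVecLin) :
    ∃ K : Matrix B B ℂ, K.PosSemidef ∧ ρ = V * (K * K) * Vᴴ := by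
  have hid : cfc (fun x : ℝ => x) ρ = ρ := cfc_id' ℝ _ hρ.isHermitian.isSelfAdjoint
  -- This factorization puts the columns of `√ρ` in the range of `ρ`, hence of `V`, so that `√ρ = V
  -- L` for some `L`; then `K = √(L Lᴴ)`.
  have hG : CFC.sqrt ρ = ρ * cfc (fun x : ℝ => (√x)⁻¹) ρ := by
    have h := cfc_mul_cfc (D := ρ) (fun x => x) fun x => (√x)⁻¹
    rw [hid] at h
    rw [h, CFC.sqrt_eq_real_sqrt _ (Matrix.nonneg_iff_posSemidef.mpr hρ), cfcₙ_eq_cfc]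
    exact congrArg (fun f => cfc f ρ) (funext fun x => Real.div_sqrt.symm)
  have hcol : ∀ a, ∃ w : B → ℂ, V *ᵥ w = (CFC.sqrt ρ).col a := by
    intro a
    obtain ⟨w, hw⟩ := hV ⟨(cfc (fun x : ℝ => (√x)⁻¹) ρ).col a, rfl⟩
    refine ⟨w, hw.trans ?_⟩
    rw [hG]
    rfl
  choose w hw using hcol
  set L : Matrix B A ℂ := Matrix.of fun b a => w a b with hL
  have hVL : V * L = CFC.sqrt ρ := by
    ext i a
    exact congrFun (hw a) i
  have hLL : (L * Lᴴ).PosSemidef := Matrix.posSemidef_self_mul_conjTranspose L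
  refine ⟨CFC.sqrt (L * Lᴴ), posSemidef_sqrt _, ?_⟩
  rw [sqrt_mul_sqrt hLL, ← Matrix.mul_assoc, Matrix.mul_assoc, ← Matrix.conjTranspose_mul, hVL,
    conjTranspose_sqrt, sqrt_mul_sqrt hρ]

/-- The isometry `U (ω ⊗ ·) ⊗ I_H`. -/
def dilationMatrix (H : Type*) [DecidableEq H] (U : Matrix (O × E) (O × E) ℂ) (ω : O → ℂ) :
    Matrix (O × (E × H)) (E × H) ℂ :=
  Matrix.of fun p q => if p.2.2 = q.2 then ∑ o, U (p.1, p.2.1) (o, q.1) * ω o else 0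

theorem dilationMatrix_isometry {U : Matrix (O × E) (O × E) ℂ} {ω : O → ℂ}
    (hU : U ∈ Matrix.unitaryGroup (O × E) ℂ) (hω : IsUnitVec ω) :
    (dilationMatrix H U ω)ᴴ * dilationMatrix H U ω = 1 := by
  set F : Matrix (O × E) E ℂ := Matrix.of fun p e => if p.2 = e then ω p.1 else 0 with hF
  set Wm : Matrix (O × E) E ℂ := U * F with hWm
  have h1 : ∀ p e, Wm p e = ∑ o, U p (o, e) * ω o := by
    intro p e
    simp [hWm, hF, Matrix.mul_apply, Fintype.sum_prod_type]
  have h2 : Wmᴴ * Wm = 1 := by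
    have hUU : Uᴴ * U = 1 := Matrix.mem_unitaryGroup_iff'.mp hU
    rw [hWm, Matrix.conjTranspose_mul, Matrix.mul_assoc, ← Matrix.mul_assoc Uᴴ, hUU, Matrix.one_mul]
    have h3 : star ω ⬝ᵥ ω = 1 := by
      rw [star_dotProduct_self, show ∑ a, ‖ω a‖ ^ 2 = 1 from hω, Complex.ofReal_one]
    ext e e'
    rw [dotProduct] at h3
    simp only [hF, Matrix.mul_apply, Matrix.conjTranspose_apply, Matrix.of_apply,
      Fintype.sum_prod_type, Matrix.one_apply, apply_ite star, star_zero, mul_ite, mul_zero,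
      ite_mul, zero_mul, Finset.sum_ite_eq', Finset.mem_univ, if_true]
    simp only [Pi.star_apply] at h3
    by_cases he : e = e'
    · subst he
      simp [← h3]
    · simp [he, Ne.symm he]
  ext ⟨e, h⟩ ⟨e', h'⟩
  have h4 := congrFun (congrFun h2 e) e'
  simp only [Matrix.mul_apply, Matrix.conjTranspose_apply, Fintype.sum_prod_type,
    Matrix.one_apply] at h4
  simp only [Matrix.mul_apply, Matrix.conjTranspose_apply, dilationMatrix, Matrix.of_apply, ← h1,
    Fintype.sum_prod_type, apply_ite star, star_zero, mul_ite, mul_zero,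
    ite_mul, zero_mul, Finset.sum_ite_eq', Finset.mem_univ, if_true]
  by_cases hh : h = h'
  · subst hh
    simpa [Matrix.one_apply] using h4
  · simp [hh, Ne.symm hh]

theorem ampliation_eq_traceFst {U : Matrix (O × E) (O × E) ℂ} {ω : O → ℂ}
    {𝓔 : Matrix E E ℂ →ₗ[ℂ] Matrix E E ℂ} (hU : IsDilation U ω 𝓔)
    (M : Matrix (E × H) (E × H) ℂ) :
    ampliation H 𝓔 M = traceFst (dilationMatrix H U ω * M * (dilationMatrix H U ω)ᴴ) := by
  ext ⟨e, h⟩ ⟨e', h'⟩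
  simp only [ampliation, LinearMap.coe_mk, AddHom.coe_mk, Matrix.of_apply, hU.2.2, traceFst,
    Matrix.mul_apply, Matrix.conjTranspose_apply, dilationMatrix, Fintype.sum_prod_type,
    Matrix.kroneckerMap_apply, proj, Matrix.vecMulVec_apply, Pi.star_apply, apply_ite star,
    star_zero, mul_ite, mul_zero, ite_mul, zero_mul, Finset.sum_ite_eq, Finset.mem_univ, if_true,
    star_sum, star_mul', Finset.mul_sum, Finset.sum_mul]
  refine Finset.sum_congr rfl fun o _ => ?_
  rw [Finset.sum_comm]
  refine Finset.sum_congr rfl fun x _ => Finset.sum_congr rfl fun y _ => ?_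
  rw [Finset.sum_comm]
  refine Finset.sum_congr rfl fun z _ => Finset.sum_congr rfl fun w _ => ?_
  ring

theorem evolve_eq_evolveMatrix (U : Matrix (O × E) (O × E) ℂ) (ω : O → ℂ)
    (ψ : Matrix (E × H) B ℂ) (p : O × B) (a : E × H) :
    evolve U ω (fun q => ψ q.1 q.2) (p, a) = evolveMatrix (dilationMatrix H U ω) ψ p a := by
  simp only [evolve, evolveMatrix, dilationMatrix, Matrix.of_apply, Matrix.mul_apply,
    Fintype.sum_prod_type, ite_mul, zero_mul, Finset.sum_ite_eq, Finset.mem_univ, if_true,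
    Finset.sum_mul]
  rw [Finset.sum_comm]
  simp only [mul_assoc]

theorem stateOB_eq (U : Matrix (O × E) (O × E) ℂ) (ω : O → ℂ) (ψ : Matrix (E × H) B ℂ) :
    stateOB U ω (fun q => ψ q.1 q.2) = evolveMatrix (dilationMatrix H U ω) ψ *
      (evolveMatrix (dilationMatrix H U ω) ψ)ᴴ := by
  ext p p'
  simp only [stateOB, traceSnd, proj, Matrix.of_apply, Matrix.vecMulVec_apply, Pi.star_apply,
    evolve_eq_evolveMatrix, Matrix.mul_apply, Matrix.conjTranspose_apply]

theorem transpose_mul_conjTranspose {m n : Type*} [Fintype m] [Fintype n] (M : Matrix m n ℂ) :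
    Mᵀ * Mᵀᴴ = (Mᴴ * M)ᵀ := by
  rw [Matrix.transpose_mul]
  rfl

/-- The isometry `J` does not touch `B`, so the `B`-marginal is that of the initial vector. -/
theorem traceFst_evolveMatrix {J : Matrix (O × A) A ℂ} (hJ : Jᴴ * J = 1) (ψ : Matrix A B ℂ) :
    traceFst (evolveMatrix J ψ * (evolveMatrix J ψ)ᴴ) = ψᵀ * ψᵀᴴ := by
  have h : ψᴴ * ψ = (J * ψ)ᴴ * (J * ψ) := by
    rw [Matrix.conjTranspose_mul, Matrix.mul_assoc, ← Matrix.mul_assoc Jᴴ, hJ, Matrix.one_mul]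
  rw [transpose_mul_conjTranspose, h]
  ext b b'
  simp only [traceFst, evolveMatrix, Matrix.of_apply, Matrix.mul_apply (N := (_)ᴴ),
    Matrix.mul_apply (M := (_)ᴴ), Matrix.conjTranspose_apply, Matrix.transpose_apply,
    Fintype.sum_prod_type, mul_comm]

theorem traceSnd_posSemidef {M : Matrix (O × B) (O × B) ℂ} (hM : M.PosSemidef) :
    (traceSnd M).PosSemidef := by
  have e : traceSnd M = ∑ b, M.submatrix (fun o => (o, b)) fun o => (o, b) := by
    ext o o'
    simp [traceSnd, Matrix.sum_apply]
  rw [e]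
  exact Matrix.posSemidef_sum _ fun b _ => hM.submatrix _

theorem trace_traceSnd (M : Matrix (O × B) (O × B) ℂ) : (traceSnd M).trace = M.trace := by
  simp [Matrix.trace, traceSnd, Fintype.sum_prod_type]

theorem trace_traceFst (M : Matrix (O × B) (O × B) ℂ) : (traceFst M).trace = M.trace := by
  simp only [Matrix.trace, Matrix.diag, traceFst, Matrix.of_apply, Fintype.sum_prod_type]
  exact Finset.sum_comm

theorem trace_transpose_mul (ψ : Matrix A B ℂ) : (ψᵀ * ψᵀᴴ).trace = (ψ * ψᴴ).trace := by
  rw [transpose_mul_conjTranspose, Matrix.trace_transpose, Matrix.trace_mul_comm]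

theorem isState_evolve {J : Matrix (O × A) A ℂ} (hJ : Jᴴ * J = 1) {ψ : Matrix A B ℂ}
    (hψ : IsState (ψ * ψᴴ)) : IsState (evolveMatrix J ψ * (evolveMatrix J ψ)ᴴ) := by
  refine ⟨Matrix.posSemidef_self_mul_conjTranspose _, ?_⟩
  rw [← trace_traceFst, traceFst_evolveMatrix hJ, trace_transpose_mul, hψ.2]

theorem IsState.kronecker {S : Matrix O O ℂ} {R : Matrix B B ℂ} (hS : IsState S)
    (hR : IsState R) : IsState (S ⊗ₖ R) :=
  ⟨hS.1.kronecker hR.1, by rw [Matrix.trace_kronecker, hS.2, hR.2, one_mul]⟩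

theorem isState_transpose {ψ : Matrix A B ℂ} (hψ : IsState (ψ * ψᴴ)) : IsState (ψᵀ * ψᵀᴴ) :=
  ⟨Matrix.posSemidef_self_mul_conjTranspose _, by rw [trace_transpose_mul, hψ.2]⟩

theorem isPurification_matrix (ψ : Matrix A B ℂ) :
    IsPurification (fun q : A × B => ψ q.1 q.2) (ψ * ψᴴ) := by
  ext a a'
  simp [traceSnd, proj, Matrix.vecMulVec_apply, Matrix.mul_apply]

/-- If `O` decouples from every purification of a code state, then the noise is correctable. -/
theorem isCorrectable_of_decouplingBound {U : Matrix (O × E) (O × E) ℂ} {ω : O → ℂ}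
    {𝓔 : Matrix E E ℂ →ₗ[ℂ] Matrix E E ℂ} (hU : IsDilation U ω 𝓔) {Ψ : (E × H) × B → ℂ} {δ : ℝ}
    (hδ : DecouplingBound Ψ U ω δ) :
    IsCorrectable (codeSpace Ψ) (ampliation H 𝓔) √(δ / 2) := by
  refine isCorrectable_of_forall (ampliation_eq_traceFst hU) _ fun ρ hρ => ?_
  set J := dilationMatrix H U ω with hJdef
  have hJ : Jᴴ * J = 1 := dilationMatrix_isometry hU.1 hU.2.1
  obtain ⟨K, hK, hKρ⟩ := exists_eq_mul_sqrt hρ.1.1 hρ.2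
  set ψ : Matrix (E × H) B ℂ := encoding Ψ * K with hψdef
  have hρψ : ρ = ψ * ψᴴ := by
    rw [hKρ, hψdef, Matrix.conjTranspose_mul, hK.isHermitian.eq]
    simp only [Matrix.mul_assoc]
  have hψ : IsState (ψ * ψᴴ) := hρψ ▸ hρ.1
  have hd := hδ ρ hρ _ (hρψ ▸ isPurification_matrix ψ)
  rw [decouplingError, stateOB_eq, ← hJdef, traceFst_evolveMatrix hJ] at hd
  have hσ := isState_evolve hJ hψ
  set σ := evolveMatrix J ψ * (evolveMatrix J ψ)ᴴ with hσdef
  have hS : IsState (traceSnd σ) := ⟨traceSnd_posSemidef hσ.1, by rw [trace_traceSnd, hσ.2]⟩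
  have hτ := hS.kronecker (isState_transpose hψ)
  obtain ⟨T, hT, hT1⟩ := exists_recovery_sqrt J hψ hS
  obtain ⟨R, hR, hR1, -⟩ := exists_powersStormer hσ hτ
  have hn := hR.re_trace_mul_le_traceNorm (hσ.1.isHermitian.sub hτ.1.isHermitian)
  exact ⟨T, hT, _, by linarith, hρψ ▸ hT1⟩

end Decoupling

/-! ### A qubit that is maximally entangled with the code -/

section Qubit

variable {A O B E H : Type*} [Fintype A] [DecidableEq A] [Fintype O] [DecidableEq O]
  [Fintype B] [DecidableEq B] [Fintype E] [DecidableEq E] [Fintype H] [DecidableEq H]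

theorem isContraction_of_isometry {m n : Type*} [Fintype m] [DecidableEq m] [Fintype n]
    [DecidableEq n] {V : Matrix m n ℂ} (hV : Vᴴ * V = 1) : IsContraction V := by
  rw [IsContraction, hV, sub_self]
  exact Matrix.PosSemidef.zero

theorem IsContraction.block {T : Matrix (O × B) (O × B) ℂ} (hT : IsContraction T) (b : B) :
    IsContraction (T.submatrix (fun o => (o, b)) fun o => (o, b)) := by
  set P : Matrix (O × B) O ℂ := (1 : Matrix (O × B) (O × B) ℂ).submatrix id fun o => (o, b)
    with hP
  have hPP : Pᴴ * P = 1 := by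
    ext o o'
    simp [hP, Matrix.mul_apply, Matrix.one_apply, eq_comm]
  have h : T.submatrix (fun o => (o, b)) (fun o => (o, b)) = Pᴴ * (T * P) := by
    ext o o'
    simp [hP, Matrix.mul_apply, Matrix.one_apply]
  rw [h]
  have hc := isContraction_of_isometry hPP
  exact hc.conjTranspose.mul (hT.mul hc)

theorem sub_kronecker (S T : Matrix O O ℂ) (N : Matrix B B ℂ) :
    (S - T) ⊗ₖ N = S ⊗ₖ N - T ⊗ₖ N := by
  ext
  simp [sub_mul]

theorem IsContraction.kronecker_unitary {T : Matrix O O ℂ} (hT : IsContraction T)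
    {N : Matrix B B ℂ} (hN : Nᴴ * N = 1) : IsContraction (T ⊗ₖ N) := by
  have e : 1 - (T ⊗ₖ N)ᴴ * (T ⊗ₖ N) = (1 - Tᴴ * T) ⊗ₖ (1 : Matrix B B ℂ) := by
    rw [Matrix.conjTranspose_kronecker, ← Matrix.mul_kronecker_mul, hN, sub_kronecker,
      Matrix.one_kronecker_one]
  rw [IsContraction, e]
  exact Matrix.PosSemidef.kronecker hT Matrix.PosSemidef.one

/-- Operators on the reference system commute with the evolution; the transpose appears because `B`
passes from column index to row index. -/
theorem evolveMatrix_mul (J : Matrix (O × A) A ℂ) (ψ : Matrix A B ℂ) (M : Matrix B B ℂ) :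
    evolveMatrix J (ψ * M) = ((1 : Matrix O O ℂ) ⊗ₖ Mᵀ) * evolveMatrix J ψ := by
  ext ⟨o, b⟩ a
  rw [evolveMatrix, Matrix.of_apply, ← Matrix.mul_assoc, Matrix.mul_apply, Matrix.mul_apply]
  simp [evolveMatrix, Fintype.sum_prod_type, Matrix.one_apply, mul_comm]

theorem traceSnd_mul_comm (M : Matrix (O × B) (O × B) ℂ) (N : Matrix B B ℂ) :
    traceSnd (((1 : Matrix O O ℂ) ⊗ₖ N) * M) = traceSnd (M * ((1 : Matrix O O ℂ) ⊗ₖ N)) := by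
  ext o o'
  simp only [traceSnd, Matrix.of_apply, Matrix.mul_apply, Fintype.sum_prod_type,
    Matrix.kroneckerMap_apply, Matrix.one_apply, ite_mul, one_mul, zero_mul, mul_ite, mul_zero]
  simp only [Finset.sum_ite_irrel, Finset.sum_const_zero, Finset.sum_ite_eq, Finset.sum_ite_eq',
    Finset.mem_univ, if_true]
  rw [Finset.sum_comm]
  simp only [mul_comm]

/-- The diagonal sign matrix `|b₀⟩⟨b₀| - |b₁⟩⟨b₁|` when `b₀` is one of two basis vectors. -/
def signMatrix (b₀ : B) : Matrix B B ℂ := Matrix.diagonal fun b => if b = b₀ then 1 else -1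

theorem signMatrix_unitary (b₀ : B) : (signMatrix b₀)ᴴ * signMatrix b₀ = 1 := by
  rw [signMatrix, Matrix.diagonal_conjTranspose, Matrix.diagonal_mul_diagonal,
    ← Matrix.diagonal_one]
  congr 1
  ext b
  by_cases h : b = b₀ <;> simp [h]

/-- Adding to `M` its conjugate by the sign matrix on the qubit doubles the diagonal blocks and
kills the others. What `2 (traceSnd M ⊗ 1)` contains beyond this sum is twice the two diagonal
blocks, interchanged. -/
theorem posSemidef_two_smul_traceSnd_sub {b₀ b₁ : B} (hb : b₀ ≠ b₁)
    (hB : (Finset.univ : Finset B) = {b₀, b₁}) {M : Matrix (O × B) (O × B) ℂ}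
    (hM : M.PosSemidef) : ((2 : ℝ) • (traceSnd M ⊗ₖ (1 : Matrix B B ℂ)) - M).PosSemidef := by
  set Z : Matrix (O × B) (O × B) ℂ := (1 : Matrix O O ℂ) ⊗ₖ signMatrix b₀ with hZ
  set D : B → Matrix B B ℂ := fun c => Matrix.diagonal fun b => if b = c then 1 else 0 with hD
  set M' : B → Matrix O O ℂ := fun c => M.submatrix (fun o => (o, c)) fun o => (o, c) with hM'
  have hDp : ∀ c, (D c).PosSemidef := fun c => Matrix.PosSemidef.diagonal fun b => by
    by_cases h : b = c <;> simp [h]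
  have e : (2 : ℝ) • (traceSnd M ⊗ₖ (1 : Matrix B B ℂ)) - M =
      Z * M * Zᴴ + (2 : ℝ) • (M' b₁ ⊗ₖ D b₀ + M' b₀ ⊗ₖ D b₁) := by
    have hs : ∀ f : B → ℂ, ∑ b, f b = f b₀ + f b₁ := fun f => by rw [hB, Finset.sum_pair hb]
    have hZM : ∀ o b o' b', (Z * M * Zᴴ) (o, b) (o', b') =
        (if b = b₀ then 1 else -1) * M (o, b) (o', b') * (if b' = b₀ then 1 else -1) := by
      have hZd : Z = Matrix.diagonal fun p : O × B => if p.2 = b₀ then 1 else -1 := by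
        rw [hZ, signMatrix, ← Matrix.diagonal_one, Matrix.diagonal_kronecker_diagonal]
        simp
      intro o b o' b'
      rw [hZd, Matrix.diagonal_conjTranspose, Matrix.mul_diagonal, Matrix.diagonal_mul]
      by_cases h : b' = b₀ <;> simp [h]
    have hc : ∀ b : B, b = b₀ ∨ b = b₁ := fun b => by
      have := Finset.mem_univ b
      rw [hB] at this
      simpa using this
    ext ⟨o, b⟩ ⟨o', b'⟩
    rw [Matrix.add_apply, hZM]
    simp only [Matrix.sub_apply, Matrix.smul_apply, Matrix.add_apply, Matrix.kroneckerMap_apply,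
      traceSnd, Matrix.of_apply, hs, hD, hM', Matrix.submatrix_apply, Matrix.diagonal_apply,
      Matrix.one_apply, Complex.real_smul]
    rcases hc b with rfl | rfl <;> rcases hc b' with rfl | rfl <;>
      simp [hb, hb.symm] <;> ring
  rw [e]
  exact (hM.mul_mul_conjTranspose_same Z).add ((((hM.submatrix _).kronecker (hDp _)).add
    ((hM.submatrix _).kronecker (hDp _))).smul (by norm_num))

/-- With `x = cos θ` and `y = sin θ`, the left side is `sin 2θ + |cos 2θ|`, at most `√2`. The weaker
bound `3 / 2` is just what the improved Powers–Størmer inequality can absorb. -/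
theorem two_mul_add_abs_le {x y : ℝ} (hx : 0 ≤ x) (hy : 0 ≤ y) (h : x ^ 2 + y ^ 2 = 1) :
    2 * (x * y) + (|x ^ 2 - x * y| + |y ^ 2 - x * y|) ≤ 3 / 2 := by
  rcases le_total x y with hxy | hxy
  · rw [abs_of_nonpos (by nlinarith), abs_of_nonneg (by nlinarith)]
    nlinarith [sq_nonneg (2 * (x * y) - (y ^ 2 - x ^ 2)), sq_nonneg (2 * (x * y) + (y ^ 2 - x ^ 2)),
      mul_nonneg hx hy]
  · rw [abs_of_nonneg (by nlinarith), abs_of_nonpos (by nlinarith)]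
    nlinarith [sq_nonneg (2 * (x * y) - (x ^ 2 - y ^ 2)), sq_nonneg (2 * (x * y) + (x ^ 2 - y ^ 2)),
      mul_nonneg hx hy]

/-- For an operator `X` with vanishing partial trace over a qubit, conjugation by the square root
of a state of the qubit, times `√2`, increases the trace norm by a factor of at most `3 / 2`. -/
theorem re_trace_conj_diagonal_le {b₀ b₁ : B} (hb : b₀ ≠ b₁)
    (hB : (Finset.univ : Finset B) = {b₀, b₁}) {X : Matrix (O × B) (O × B) ℂ}
    (hX : traceSnd X = 0) {n : ℝ} (hn : ∀ R, IsContraction R → (R * X).trace.re ≤ n)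
    {d : B → ℝ} (hd : ∀ b, 0 ≤ d b) (hd1 : ∑ b, d b ^ 2 = 1)
    {T : Matrix (O × B) (O × B) ℂ} (hT : IsContraction T) :
    (T * ((1 ⊗ₖ Matrix.diagonal fun b => (d b : ℂ)) * X *
      (1 ⊗ₖ Matrix.diagonal fun b => (d b : ℂ)))).trace.re ≤ 3 / 4 * n := by
  have hs : ∀ f : B → ℂ, ∑ b, f b = f b₀ + f b₁ := fun f => by rw [hB, Finset.sum_pair hb]
  set t : B → B → ℂ := fun b b' => ∑ o, ∑ o', T (o, b) (o', b') * X (o', b') (o, b) with ht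
  have hXX : ∀ o o', X (o, b₁) (o', b₁) = -X (o, b₀) (o', b₀) := by
    intro o o'
    have h := congrFun (congrFun hX o) o'
    simp only [traceSnd, Matrix.of_apply, hs, Matrix.zero_apply] at h
    exact eq_neg_of_add_eq_zero_right h
  have htr : ∀ R : Matrix (O × B) (O × B) ℂ, ∀ Y : Matrix (O × B) (O × B) ℂ, (R * Y).trace =
      ∑ b, ∑ b', ∑ o, ∑ o', R (o, b) (o', b') * Y (o', b') (o, b) := by
    intro R Y
    simp only [Matrix.trace, Matrix.diag, Matrix.mul_apply, Fintype.sum_prod_type_right]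
    refine Finset.sum_congr rfl fun b _ => ?_
    rw [Finset.sum_comm]
  -- The diagonal blocks of `X` are opposite, so the contraction formed from the block `T_bb` and
  -- the sign matrix collects `t b b` twice.
  have hblock : ∀ b, b = b₀ ∨ b = b₁ → |(t b b).re| ≤ n / 2 := by
    intro b hbb
    have h0 := (hT.block b).kronecker_unitary (signMatrix_unitary b)
    have e : ((T.submatrix (fun o => (o, b)) fun o => (o, b)) ⊗ₖ signMatrix b * X).trace =
        2 * t b b := by
      rw [htr]
      simp only [hs, ht, Matrix.kroneckerMap_apply, Matrix.submatrix_apply, signMatrix,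
        Matrix.diagonal_apply]
      rcases hbb with rfl | rfl
      · simp [hb, hb.symm, hXX, two_mul]
      · simp [hb, hb.symm, hXX, two_mul]
    have h1 := hn _ h0
    have h2 := hn _ h0.neg
    rw [Matrix.neg_mul, Matrix.trace_neg, Complex.neg_re] at h2
    rw [e] at h1 h2
    simp only [Complex.mul_re, Complex.re_ofNat, Complex.im_ofNat, zero_mul, sub_zero] at h1 h2
    rw [abs_le]
    constructor <;> linarith
  have hTX : (t b₀ b₀ + t b₀ b₁ + (t b₁ b₀ + t b₁ b₁)).re ≤ n := by
    have h := hn T hT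
    rw [htr] at h
    simpa only [hs] using h
  have htot : (T * ((1 ⊗ₖ Matrix.diagonal fun b => (d b : ℂ)) * X *
      (1 ⊗ₖ Matrix.diagonal fun b => (d b : ℂ)))).trace =
      ∑ b, ∑ b', ((d b * d b' : ℝ) : ℂ) * t b b' := by
    rw [htr]
    refine Finset.sum_congr rfl fun b _ => Finset.sum_congr rfl fun b' _ => ?_
    rw [ht, Finset.mul_sum]
    refine Finset.sum_congr rfl fun o _ => ?_
    rw [Finset.mul_sum]
    refine Finset.sum_congr rfl fun o' _ => ?_
    rw [← Matrix.diagonal_one, Matrix.diagonal_kronecker_diagonal, Matrix.mul_diagonal,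
      Matrix.diagonal_mul]
    push_cast
    ring
  have hn0 : 0 ≤ n := by
    have h := hn 0 (by simpa [IsContraction] using Matrix.PosSemidef.one)
    simpa using h
  have hd1' : d b₀ ^ 2 + d b₁ ^ 2 = 1 := by
    rw [← hd1, hB, Finset.sum_pair hb]
  rw [htot]
  simp only [hs, Complex.add_re, Complex.re_ofReal_mul] at hTX ⊢
  have k0 := hblock b₀ (Or.inl rfl)
  have k1 := hblock b₁ (Or.inr rfl)
  have hc := two_mul_add_abs_le (hd b₀) (hd b₁) hd1'
  have hp := mul_nonneg (hd b₀) (hd b₁)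
  -- The weighted sum is split as `d b₀ * d b₁` times the full pairing with `X`, plus corrections on
  -- the diagonal blocks only; the first costs `n`, each diagonal pairing at most `n / 2`.
  have p0 : (d b₀ ^ 2 - d b₀ * d b₁) * (t b₀ b₀).re ≤ |d b₀ ^ 2 - d b₀ * d b₁| * (n / 2) :=
    (le_abs_self _).trans ((abs_mul _ _).trans_le (mul_le_mul_of_nonneg_left k0 (abs_nonneg _)))
  have p1 : (d b₁ ^ 2 - d b₀ * d b₁) * (t b₁ b₁).re ≤ |d b₁ ^ 2 - d b₀ * d b₁| * (n / 2) :=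
    (le_abs_self _).trans ((abs_mul _ _).trans_le (mul_le_mul_of_nonneg_left k1 (abs_nonneg _)))
  have p2 := mul_le_mul_of_nonneg_left hTX hp
  have p3 := mul_le_mul_of_nonneg_right hc (by linarith : 0 ≤ n / 2)
  linarith

end Qubit

/-! ### Isometric qubit codes: from decoupling for `Ψ` to recovery of every code state -/

section MaximallyEntangled

variable {O B E H : Type*} [Fintype O] [DecidableEq O]
  [Fintype B] [DecidableEq B] [Fintype E] [DecidableEq E] [Fintype H] [DecidableEq H]

theorem exists_diagonalization {K : Matrix B B ℂ} (hK : K.PosSemidef) :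
    ∃ (Y : Matrix B B ℂ) (d : B → ℝ), Yᴴ * Y = 1 ∧ Y * Yᴴ = 1 ∧ (∀ b, 0 ≤ d b) ∧
      K = Y * (Matrix.diagonal fun b => (d b : ℂ)) * Yᴴ := by
  refine ⟨hK.isHermitian.eigenvectorUnitary, hK.isHermitian.eigenvalues,
    Matrix.mem_unitaryGroup_iff'.mp (SetLike.coe_mem _),
    Matrix.mem_unitaryGroup_iff.mp (SetLike.coe_mem _), hK.eigenvalues_nonneg, ?_⟩
  have h := hK.isHermitian.spectral_theorem
  rwa [Unitary.conjStarAlgAut_apply] at h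

/-- If `B` is a qubit that is maximally entangled with the code, then the decoupling of `O` and `B`
makes the noise correctable. -/
theorem isCorrectable_of_isIsometricEncoding {U : Matrix (O × E) (O × E) ℂ} {ω : O → ℂ}
    {𝓔 : Matrix E E ℂ →ₗ[ℂ] Matrix E E ℂ} (hU : IsDilation U ω 𝓔) {Ψ : (E × H) × B → ℂ}
    (hB : Fintype.card B = 2) (hV : IsIsometricEncoding Ψ) {δ : ℝ}
    (hδ : decouplingError U ω Ψ ≤ δ) :
    IsCorrectable (codeSpace Ψ) (ampliation H 𝓔) √(δ / 2) := by
  obtain ⟨b₀, b₁, hb, hbu⟩ := Finset.card_eq_two.mp (Finset.card_univ.trans hB)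
  refine isCorrectable_of_forall (ampliation_eq_traceFst hU) _ fun ρ hρ => ?_
  set J := dilationMatrix H U ω with hJdef
  have hJ : Jᴴ * J = 1 := dilationMatrix_isometry hU.1 hU.2.1
  obtain ⟨K, hK, hKρ⟩ := exists_eq_mul_sqrt hρ.1.1 hρ.2
  obtain ⟨Y, d, hY, hY', hd, hKd⟩ := exists_diagonalization hK
  set D : Matrix B B ℂ := Matrix.diagonal fun b => (d b : ℂ) with hD
  have hDt : Dᵀ = D := Matrix.diagonal_transpose _
  have hDh : Dᴴ = D := by
    rw [hD, Matrix.diagonal_conjTranspose]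
    congr 1
    ext b
    simp
  set V := encoding Ψ with hVdef
  have hVV : Vᴴ * V = 1 := hV
  set Ψm : Matrix (E × H) B ℂ := Matrix.of fun x k => Ψ (x, k) with hΨm
  have hVΨ : V = ((√2 : ℝ) : ℂ) • Ψm := by
    ext x k
    simp [hVdef, encoding, hΨm, hB]
  have hsq : ((√2 : ℝ) : ℂ) * ((√2 : ℝ) : ℂ) = 2 := by
    rw [← Complex.ofReal_mul, Real.mul_self_sqrt (by norm_num)]
    norm_num
  set ψ : Matrix (E × H) B ℂ := V * (Y * D) with hψdef
  have hρψ : ρ = ψ * ψᴴ := by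
    rw [hKρ, hψdef, hKd]
    simp only [Matrix.conjTranspose_mul, hDh, Matrix.mul_assoc]
    rw [← Matrix.mul_assoc Yᴴ Y, hY, Matrix.one_mul]
  have hψ : IsState (ψ * ψᴴ) := hρψ ▸ hρ.1
  have hψD : ψᵀ * ψᵀᴴ = D * D := by
    have h1 : ψᴴ * ψ = D * D := by
      rw [hψdef]
      simp only [Matrix.conjTranspose_mul, hDh, Matrix.mul_assoc]
      rw [← Matrix.mul_assoc Vᴴ, hVV, Matrix.one_mul, ← Matrix.mul_assoc Yᴴ, hY, Matrix.one_mul]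
    rw [transpose_mul_conjTranspose, h1, Matrix.transpose_mul, hDt]
  have hd1 : ∑ b, d b ^ 2 = 1 := by
    have h := (isState_transpose hψ).2
    rw [hψD, hD, Matrix.diagonal_mul_diagonal, Matrix.trace_diagonal] at h
    simp only [← sq] at h
    exact_mod_cast h
  set σ := evolveMatrix J Ψm * (evolveMatrix J Ψm)ᴴ with hσdef
  have hσp : σ.PosSemidef := Matrix.posSemidef_self_mul_conjTranspose _
  set S := traceSnd σ with hSdef
  have hΨt : (2 : ℂ) • (Ψmᵀ * Ψmᵀᴴ) = 1 := by
    have h1 : (2 : ℂ) • (Ψmᴴ * Ψm) = 1 := by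
      rw [hVΨ] at hVV
      rw [← hVV, Matrix.conjTranspose_smul, Matrix.smul_mul, Matrix.mul_smul, smul_smul,
        Complex.star_def, Complex.conj_ofReal, hsq]
    rw [transpose_mul_conjTranspose, ← Matrix.transpose_smul, h1, Matrix.transpose_one]
  have hfst : traceFst σ = (2⁻¹ : ℂ) • 1 := by
    rw [hσdef, traceFst_evolveMatrix hJ, ← hΨt, smul_smul]
    norm_num
  have hS : IsState S := by
    refine ⟨traceSnd_posSemidef hσp, ?_⟩
    rw [hSdef, trace_traceSnd, ← trace_traceFst, hfst, Matrix.trace_smul, Matrix.trace_one, hB]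
    norm_num
  set X := σ - S ⊗ₖ traceFst σ with hX
  have hXn : traceNorm X ≤ δ := by
    have h := hδ
    rwa [decouplingError, show Ψ = fun q => Ψm q.1 q.2 from rfl, stateOB_eq] at h
  have hXh : X.IsHermitian := by
    have h : (traceFst σ).PosSemidef := by
      rw [hσdef, traceFst_evolveMatrix hJ]
      exact Matrix.posSemidef_self_mul_conjTranspose _
    exact hσp.isHermitian.sub (hS.1.kronecker h).isHermitian
  set Q : Matrix (O × B) (O × B) ℂ := 1 ⊗ₖ Yᵀ with hQ
  have hYt : Yᵀᴴ * Yᵀ = 1 := by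
    have h : Yᵀᴴ * Yᵀ = (Y * Yᴴ)ᵀ := by rw [Matrix.transpose_mul]; rfl
    rw [h, hY', Matrix.transpose_one]
  have hYt' : Yᵀ * Yᵀᴴ = 1 := by
    rw [transpose_mul_conjTranspose, hY, Matrix.transpose_one]
  have hQh : Qᴴ = 1 ⊗ₖ Yᵀᴴ := by
    rw [hQ, Matrix.conjTranspose_kronecker, Matrix.conjTranspose_one]
  have hQQ : Qᴴ * Q = 1 := by
    rw [hQh, hQ, ← Matrix.mul_kronecker_mul, hYt, Matrix.one_mul, Matrix.one_kronecker_one]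
  have hQt : ∀ M : Matrix (O × B) (O × B) ℂ, traceSnd (Q * M * Qᴴ) = traceSnd M := by
    intro M
    rw [Matrix.mul_assoc, hQ, traceSnd_mul_comm, ← hQ, Matrix.mul_assoc, hQQ, Matrix.mul_one]
  set G : Matrix (O × B) (O × B) ℂ := 1 ⊗ₖ D with hG
  have hGh : Gᴴ = G := by
    rw [hG, Matrix.conjTranspose_kronecker, Matrix.conjTranspose_one, hDh]
  have hσψ : evolveMatrix J ψ * (evolveMatrix J ψ)ᴴ = (2 : ℂ) • (G * (Q * σ * Qᴴ) * G) := by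
    have h1 : evolveMatrix J ψ = ((√2 : ℝ) : ℂ) • (G * (Q * evolveMatrix J Ψm)) := by
      have h2 : ψ = (Ψm * (((√2 : ℝ) : ℂ) • Y)) * D := by
        rw [hψdef, hVΨ, Matrix.smul_mul, Matrix.mul_smul, Matrix.smul_mul, Matrix.mul_assoc]
      rw [h2, evolveMatrix_mul, evolveMatrix_mul, hDt, Matrix.transpose_smul,
        Matrix.kronecker_smul, Matrix.smul_mul, Matrix.mul_smul]
    rw [h1, Matrix.conjTranspose_smul, Matrix.smul_mul, Matrix.mul_smul, smul_smul,
      Complex.star_def, Complex.conj_ofReal, hsq]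
    simp only [Matrix.conjTranspose_mul, hGh, hσdef, Matrix.mul_assoc]
  have hτψ : S ⊗ₖ (ψᵀ * ψᵀᴴ) = G * (S ⊗ₖ (1 : Matrix B B ℂ)) * G := by
    rw [hψD, hG, ← Matrix.mul_kronecker_mul, ← Matrix.mul_kronecker_mul, Matrix.one_mul,
      Matrix.mul_one, Matrix.mul_one]
  have hX' : Q * X * Qᴴ = Q * σ * Qᴴ - (2⁻¹ : ℂ) • (S ⊗ₖ (1 : Matrix B B ℂ)) := by
    have h : Q * (S ⊗ₖ (1 : Matrix B B ℂ)) * Qᴴ = S ⊗ₖ 1 := by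
      rw [hQh, hQ, ← Matrix.mul_kronecker_mul, ← Matrix.mul_kronecker_mul, Matrix.one_mul,
        Matrix.mul_one, Matrix.mul_one, hYt']
    rw [hX, hfst, Matrix.kronecker_smul, Matrix.mul_sub, Matrix.sub_mul, Matrix.mul_smul,
      Matrix.smul_mul, h]
  have hdiff : evolveMatrix J ψ * (evolveMatrix J ψ)ᴴ - S ⊗ₖ (ψᵀ * ψᵀᴴ) =
      (2 : ℂ) • (G * (Q * X * Qᴴ) * G) := by
    rw [hσψ, hτψ, hX', Matrix.mul_sub, Matrix.sub_mul, smul_sub, Matrix.mul_smul, Matrix.smul_mul,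
      smul_smul]
    norm_num
  have hX0 : traceSnd (Q * X * Qᴴ) = 0 := by
    rw [hQt]
    ext o o'
    have e : traceSnd X o o' = traceSnd σ o o' - S o o' * (traceFst σ).trace := by
      simp [traceSnd, hX, Finset.sum_sub_distrib, Matrix.trace, Finset.mul_sum]
    rw [e, hfst, Matrix.trace_smul, Matrix.trace_one, hB, ← hSdef]
    norm_num
  have hpair : ∀ R, IsContraction R → (R * (Q * X * Qᴴ)).trace.re ≤ δ := by
    intro R hR
    have e : (R * (Q * X * Qᴴ)).trace = (Qᴴ * (R * Q) * X).trace := by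
      rw [← Matrix.mul_assoc, Matrix.trace_mul_comm]
      simp only [Matrix.mul_assoc]
    rw [e]
    have hQc := isContraction_of_isometry hQQ
    exact ((hQc.conjTranspose.mul (hR.mul hQc)).re_trace_mul_le_traceNorm hXh).trans hXn
  have hfour : ((4 : ℝ) • (S ⊗ₖ (ψᵀ * ψᵀᴴ)) -
      evolveMatrix J ψ * (evolveMatrix J ψ)ᴴ).PosSemidef := by
    have h := posSemidef_two_smul_traceSnd_sub hb hbu (hσp.mul_mul_conjTranspose_same Q)
    rw [hQt, ← hSdef] at h
    have h2 := (h.mul_mul_conjTranspose_same G).smul (show (0 : ℝ) ≤ 2 by norm_num)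
    have e : (4 : ℝ) • (S ⊗ₖ (ψᵀ * ψᵀᴴ)) - evolveMatrix J ψ * (evolveMatrix J ψ)ᴴ =
        (2 : ℝ) • (G * ((2 : ℝ) • (S ⊗ₖ (1 : Matrix B B ℂ)) - Q * σ * Qᴴ) * Gᴴ) := by
      rw [hσψ, hτψ, hGh, Matrix.mul_sub, Matrix.sub_mul, smul_sub, Matrix.mul_smul,
        Matrix.smul_mul, smul_smul]
      congr 1
      norm_num
    rw [e]
    exact h2
  obtain ⟨T, hT, hT1⟩ := exists_recovery_sqrt J hψ hS
  obtain ⟨R, hR, -, hR1⟩ :=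
    exists_powersStormer (isState_evolve hJ hψ) (hS.kronecker (isState_transpose hψ))
  refine ⟨T, hT, _, ?_, hρψ ▸ hT1⟩
  refine le_trans ?_ (hR1 hfour)
  have hq := re_trace_conj_diagonal_le hb hbu hX0 hpair hd hd1 hR
  rw [← hD, ← hG] at hq
  rw [hdiff, Matrix.mul_smul, Matrix.trace_smul]
  simp only [smul_eq_mul, Complex.mul_re, Complex.re_ofNat, Complex.im_ofNat, zero_mul, sub_zero]
  linarith

end MaximallyEntangled

theorem sqrt_mul_two_rpow (c x : ℝ) (hc : 0 ≤ c) : √(c * 2 ^ x) = √c * 2 ^ (x / 2) := by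
  rw [Real.sqrt_mul hc, Real.sqrt_eq_rpow (2 ^ x), ← Real.rpow_mul (by norm_num)]
  congr 2
  ring

end BlackHoleCode

end


theorem lemma7p2 {O E H B : Type*}
    [Fintype O] [DecidableEq O] [Fintype E] [DecidableEq E]
    [Fintype H] [DecidableEq H] [Fintype B] [DecidableEq B]
    (α : ℝ) (Ψ : (E × H) × B → ℂ) (hΨ : BlackHoleCode.IsUnitVec Ψ)
    (𝓔 : Matrix E E ℂ →ₗ[ℂ] Matrix E E ℂ) (h𝓔 : BlackHoleCode.IsChannel 𝓔)
    (U : Matrix (O × E) (O × E) ℂ) (ω : O → ℂ) (hU : BlackHoleCode.IsDilation U ω 𝓔) :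
    -- `B` a single qubit
    (Fintype.card B = 2 →
      BlackHoleCode.DecouplingBound Ψ U ω
        (6 * 2 ^ (-(α * BlackHoleCode.numQubits H - BlackHoleCode.numQubits O))) →
      BlackHoleCode.IsCorrectable (BlackHoleCode.codeSpace Ψ) (BlackHoleCode.ampliation H 𝓔)
        (√3 * 2 ^ (-(α * BlackHoleCode.numQubits H - BlackHoleCode.numQubits O) / 2))) ∧
    -- `B` a single qubit maximally entangled with `E ⊗ H`: the bound for `Ψ` itself is enough
    (Fintype.card B = 2 → BlackHoleCode.IsIsometricEncoding Ψ →
      BlackHoleCode.decouplingError U ω Ψ ≤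
        6 * 2 ^ (-(α * BlackHoleCode.numQubits H - BlackHoleCode.numQubits O)) →
      BlackHoleCode.IsCorrectable (BlackHoleCode.codeSpace Ψ) (BlackHoleCode.ampliation H 𝓔)
        (√3 * 2 ^ (-(α * BlackHoleCode.numQubits H - BlackHoleCode.numQubits O) / 2))) ∧
    -- general `B`
    (BlackHoleCode.DecouplingBound Ψ U ω
        (3 * 2 ^ (-(α * BlackHoleCode.numQubits H - BlackHoleCode.numQubits (O × B)))) →
      BlackHoleCode.IsCorrectable (BlackHoleCode.codeSpace Ψ) (BlackHoleCode.ampliation H 𝓔)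
        (√(3 / 2) *
          2 ^ (-(α * BlackHoleCode.numQubits H - BlackHoleCode.numQubits (O × B)) / 2))) := by

  have h6 : ∀ x : ℝ, √3 * 2 ^ (-x / 2) = √(6 * 2 ^ (-x) / 2) := fun x => by
    rw [← BlackHoleCode.sqrt_mul_two_rpow _ _ (by norm_num)]
    congr 1
    ring
  have h3 : ∀ x : ℝ, √(3 / 2) * 2 ^ (-x / 2) = √(3 * 2 ^ (-x) / 2) := fun x => by
    rw [← BlackHoleCode.sqrt_mul_two_rpow _ _ (by norm_num)]
    congr 1
    ring
  rw [h6, h3]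
  exact ⟨fun _ h => BlackHoleCode.isCorrectable_of_decouplingBound hU h,
    fun hB hV h => BlackHoleCode.isCorrectable_of_isIsometricEncoding hU hB hV h,
    fun h => BlackHoleCode.isCorrectable_of_decouplingBound hU h⟩
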